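/- Let $n\ge 1$ and let $\rho,\psi:(0,\infty)\to(0,\infty)$. Write $B(z,r)$ for the open ball in $\mathbb R^n$ with centre $z$ and radius $r$, $g_B=\frac1{|B|}\int_B g$ for the mean of $g$ over a ball $B$; functions are complex valued. Put $$\rho^*(r)=\int_0^r\frac{\rho(t)}t\,dt,\qquad I_\rho f(x)=\int_{\mathbb R^n}\frac{\rho(|x-y|)}{|x-y|^n}f(y)\,dy,\qquad [b,I_\rho]f=b\,I_\rho f-I_\rho(bf),$$ $$\|b\|_{\mathcal L_{1,\psi}}=\sup_{B=B(z,r)}\frac1{\psi(r)}\frac1{|B|}\int_B|b-b_B|,\qquad M^\sharp g(x)=\sup_{B\ni x}\frac1{|B|}\int_B|g-g_B|,\qquad M_w g(x)=\sup_{B(z,r)\ni x}w(r)\frac1{|B(z,r)|}\int_{B(z,r)}|g|,$$ where $w:(0,\infty)\to(0,\infty)$ and the suprema run over all balls (over all balls containing $x$ for $M^\sharp g(x)$ and $M_wg(x)$). Let $\mathcal L_{1,\psi}$ be the set of all locally integrable $b$ with $\|b\|_{\mathcal L_{1,\psi}}<\infty$, and $L^\infty_c$ the set of essentially bounded measurable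 functions with compact support. A function $\theta:(0,\infty)\to(0,\infty)$ is almost increasing (almost decreasing) if there is a constant $C>0$ with $\theta(r)\le C\theta(s)$ (respectively $\theta(s)\le C\theta(r)$) whenever $0<r<s$. **Proposition.** Assume that $\int_0^1\rho(t)\,\frac{dt}t<\infty$, that $\psi$ is almost increasing, that $r\mapsto\rho(r)/r^{n-\epsilon}$ is almost decreasing for some $\epsilon>0$, and that there is a constant $C_\rho>0$ such that for all $r,s>0$ with $\frac12\le\frac rs\le2$, $$\left|\frac{\rho(r)}{r^n}-\frac{\rho(s)}{s^n}\right|\le C_\rho\,|r-s|\,\frac{\rho^*(r)}{r^{n+1}}.$$ Then for every $\eta\in(1,\infty)$ there is a constant $C>0$ such that for all $b\in\mathcal L_{1,\psi}$ and all $f\in L^\infty_c$ the integral $I_\rho f(x)$ converges absolutely for every $x$, the integral $I_\rho(bf)(x)$ converges absolutely for almost every $x$, the function $[b,I_\rho]f$ is locally integrable, and for all $x\in\mathbb R^n$ $$M^\sharp([b,I_\rho]f)(x)\le C\,\|b\|_{\mathcal L_{1,\psi}}\Big(\big(M_{\psi^\eta}(|I_\rho f|^\eta)(x)\big)^{1/\eta}+\big(M_{(\rho^*\psi)^\eta}(|f|^\eta)(x)\big)^{1/\eta}\Big).$$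 Here both sides take values in $[0,\infty]$, with $0\cdot\infty=0$. -/

import Mathlib

open MeasureTheory Set Metric
open scoped NNReal ENNReal

noncomputable section

namespace Campanato

/-- The Euclidean space `ℝⁿ`, with its Euclidean norm and Lebesgue measure. -/
abbrev Rn (n : ℕ) : Type := EuclideanSpace ℝ (Fin n)

/-- `θ : (0,∞) → (0,∞)` (represented by a function on `ℝ`, used only on `(0,∞)`)
is almost increasing. -/
def AlmostIncreasing (θ : ℝ → ℝ) : Prop :=
  ∃ C : ℝ, 0 < C ∧ ∀ r s : ℝ, 0 < r → r < s → θ r ≤ C * θ s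

/-- `θ : (0,∞) → (0,∞)` is almost decreasing. -/
def AlmostDecreasing (θ : ℝ → ℝ) : Prop :=
  ∃ C : ℝ, 0 < C ∧ ∀ r s : ℝ, 0 < r → r < s → θ s ≤ C * θ r

/-- `ρ*(r) = ∫₀ʳ ρ(t)/t dt`. -/
def rhoStar (ρ : ℝ → ℝ) (r : ℝ) : ℝ := ∫ t in (0 : ℝ)..r, ρ t / t

/-- The regularity condition
`|ρ(r)/rⁿ - ρ(s)/sⁿ| ≤ C_ρ |r - s| ρ*(r)/rⁿ⁺¹` whenever `1/2 ≤ r/s ≤ 2`. -/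
def KernelRegularity (n : ℕ) (ρ : ℝ → ℝ) : Prop :=
  ∃ Cρ : ℝ, 0 < Cρ ∧ ∀ r s : ℝ, 0 < r → 0 < s → 1 / 2 ≤ r / s → r / s ≤ 2 →
    |ρ r / r ^ n - ρ s / s ^ n| ≤ Cρ * |r - s| * (rhoStar ρ r / r ^ (n + 1))

variable {n : ℕ}

/-- The integrand `y ↦ ρ(|x-y|)/|x-y|ⁿ f(y)` of the generalized fractional integral at `x`. -/
def fracIntegrand (ρ : ℝ → ℝ) (f : Rn n → ℂ) (x y : Rn n) : ℂ :=
  (ρ ‖x - y‖ / ‖x - y‖ ^ n) • f y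

/-- The generalized fractional integral
`I_ρ f(x) = ∫ ρ(|x-y|)/|x-y|ⁿ f(y) dy`. -/
def fracIntegral (ρ : ℝ → ℝ) (f : Rn n → ℂ) (x : Rn n) : ℂ :=
  ∫ y, fracIntegrand ρ f x y

/-- The commutator `[b, I_ρ] f = b I_ρ f - I_ρ (b f)`. -/
def commutator (ρ : ℝ → ℝ) (b f : Rn n → ℂ) (x : Rn n) : ℂ :=
  b x * fracIntegral ρ f x - fracIntegral ρ (fun y => b y * f y) x

/-- The mean oscillation of `f` over the ball `B(z,r)`: the mean over `B` of `|f - f_B|`. -/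
def meanOsc (f : Rn n → ℂ) (z : Rn n) (r : ℝ) : ℝ≥0∞ :=
  ⨍⁻ y in ball z r, ‖f y - ⨍ w in ball z r, f w ∂volume‖ₑ ∂volume

/-- The generalized Campanato norm `‖f‖_{𝓛_{1,ψ}}`: the supremum over all balls `B(z,r)` of
`ψ(r)⁻¹` times the mean oscillation. -/
def campanatoNorm (ψ : ℝ → ℝ) (f : Rn n → ℂ) : ℝ≥0∞ :=
  ⨆ (z : Rn n) (r : ℝ) (_ : 0 < r), (ENNReal.ofReal (ψ r))⁻¹ * meanOsc f z r

/-- Membership in `𝓛_{1,ψ}(ℝⁿ)`. -/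
def MemCampanato (ψ : ℝ → ℝ) (f : Rn n → ℂ) : Prop :=
  LocallyIntegrable f ∧ campanatoNorm ψ f < ∞

/-- The sharp maximal function `M♯ f(x)`: supremum over all balls containing `x`. -/
def sharpMaximal (f : Rn n → ℂ) (x : Rn n) : ℝ≥0∞ :=
  ⨆ (z : Rn n) (r : ℝ) (_ : 0 < r) (_ : x ∈ ball z r), meanOsc f z r

/-- The generalized fractional maximal function `M_w g(x)`: the supremum, over all balls `B(z,r)`
containing `x`, of `w(r)` times the mean of `|g|` over the ball. -/
def fracMaximal (w : ℝ → ℝ) (g : Rn n → ℝ) (x : Rn n) : ℝ≥0∞ :=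
  ⨆ (z : Rn n) (r : ℝ) (_ : 0 < r) (_ : x ∈ ball z r),
    ENNReal.ofReal (w r) * ⨍⁻ y in ball z r, ‖g y‖ₑ ∂volume

/-- `f ∈ L^∞_c(ℝⁿ)`: essentially bounded, measurable, and vanishing a.e. off a compact set. -/
def MemLinftyc (f : Rn n → ℂ) : Prop :=
  MemLp f ∞ ∧ ∃ K : Set (Rn n), IsCompact K ∧ ∀ᵐ y, y ∉ K → f y = 0

end Campanato

end

namespace Campanato

variable {n : ℕ}

/-! Fix a ball `B = B(z,r)` containing the point and let `c` be the mean of `b` over `2B`.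
Commutators do not see additive constants in `b`, so off a null set `[b,I_ρ]f` equals `(b-c) I_ρ f -
I_ρ((b-c) f)`. Splitting the second integral at `2B` and freezing the kernel of the far part at `z`
changes it by a constant, and mean oscillation ignores constants up to a factor 2 (`meanOsc_le`).
Three terms remain (`exists_ae_enorm_commutator_add_le`).

The product `(b-c) I_ρ f` needs a bound for the mean of `|b-c||g|`. Hölder's inequality reduces this
to the `η`-mean of `g` and a conjugate-exponent mean of `b-c`, which the John–Nirenberg inequality
controls. On the dilate `2^j · 2B` the means of `b` drift by at most a multiple of `j`, so the bound
grows linearly in `j` (`exists_laverage_deviation_mul_le`).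

The near part is averaged over `B` by Tonelli: in polar coordinates the kernel integrates to a
multiple of `ρ*` (`lintegral_fracIntegrand_le`), so an `L¹` estimate suffices. The far part uses the
regularity of the kernel on dyadic annuli, which gains `2^{-j}` (`lintegral_kernel_sub_kernel_le`);
this beats the linear growth, and `∑ (j+1) 2^{-j}` converges.

John–Nirenberg is obtained from a stopping-time covering by balls (`exists_stopping_balls`): raising
the level by a fixed multiple of the oscillation halves the exceptional proportion. -/

/-! ### Averages and mean oscillation over balls. -/

theorem volume_ball_mul (x y : Rn n) {t : ℝ} (ht : 0 < t) (r : ℝ) :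
    volume (ball x (t * r)) = ENNReal.ofReal (t ^ n) * volume (ball y r) := by
  have h := Measure.addHaar_ball_mul_of_pos (volume : Measure (Rn n)) x ht r
  rw [h, Measure.addHaar_ball_center volume y r]
  simp

theorem volume_ball_pos (x : Rn n) {r : ℝ} (hr : 0 < r) : volume (ball x r) ≠ 0 :=
  (measure_ball_pos volume x hr).ne'

theorem volume_ball_ne_top (x : Rn n) (r : ℝ) : volume (ball x r) ≠ ∞ :=
  measure_ball_lt_top.ne

theorem laverage_ball_eq (F : Rn n → ℝ≥0∞) (z : Rn n) (r : ℝ) :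
    ⨍⁻ y in ball z r, F y ∂volume = (∫⁻ y in ball z r, F y) / volume (ball z r) := by
  rw [setLAverage_eq]

theorem volume_mul_laverage_ball (F : Rn n → ℝ≥0∞) (z : Rn n) (r : ℝ) :
    volume (ball z r) * ⨍⁻ y in ball z r, F y ∂volume = ∫⁻ y in ball z r, F y :=
  measure_mul_setLAverage F (volume_ball_ne_top z r)

theorem laverage_ball_le_of_subset (F : Rn n → ℝ≥0∞) {x y : Rn n} {r t : ℝ} (ht : 0 < t)
    (h : ball x r ⊆ ball y (t * r)) :
    ⨍⁻ w in ball x r, F w ∂volume ≤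
      ENNReal.ofReal (t ^ n) * ⨍⁻ w in ball y (t * r), F w ∂volume := by
  have h0 : ENNReal.ofReal (t ^ n) ≠ 0 := by
    rw [Ne, ENNReal.ofReal_eq_zero, not_le]; positivity
  rw [laverage_ball_eq, laverage_ball_eq, volume_ball_mul y x ht, div_eq_mul_inv,
    div_eq_mul_inv, ENNReal.mul_inv (Or.inl h0) (Or.inl ENNReal.ofReal_ne_top)]
  calc (∫⁻ w in ball x r, F w) * (volume (ball x r))⁻¹
      ≤ (∫⁻ w in ball y (t * r), F w) * (volume (ball x r))⁻¹ := by
        gcongr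
    _ = (ENNReal.ofReal (t ^ n) * (ENNReal.ofReal (t ^ n))⁻¹) *
          ((∫⁻ w in ball y (t * r), F w) * (volume (ball x r))⁻¹) := by
        rw [ENNReal.mul_inv_cancel h0 ENNReal.ofReal_ne_top, one_mul]
    _ = _ := by ring

theorem ball_two_mul_subset (z : Rn n) {s : ℝ} (hs : 0 < s) : ball z s ⊆ ball z (2 * s) :=
  ball_subset_ball (by linarith)

theorem laverage_ball_le_two (F : Rn n → ℝ≥0∞) (z : Rn n) {s : ℝ} (hs : 0 < s) :
    ⨍⁻ w in ball z s, F w ∂volume ≤ 2 ^ n * ⨍⁻ w in ball z (2 * s), F w ∂volume := by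
  have := laverage_ball_le_of_subset F (t := 2) two_pos (ball_two_mul_subset z hs)
  rwa [ENNReal.ofReal_pow zero_le_two, ENNReal.ofReal_ofNat] at this

theorem laverage_ball_const (c : ℝ≥0∞) (z : Rn n) {r : ℝ} (hr : 0 < r) :
    ⨍⁻ _w in ball z r, c ∂volume = c :=
  setLAverage_const (volume_ball_pos z hr) (volume_ball_ne_top z r) c

theorem laverage_const_mul {α : Type*} [MeasurableSpace α] {μ : Measure α} {c : ℝ≥0∞}
    (hc : c ≠ ∞) (F : α → ℝ≥0∞) : ⨍⁻ w, c * F w ∂μ = c * ⨍⁻ w, F w ∂μ := by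
  rw [laverage_eq', laverage_eq', lintegral_const_mul' _ _ hc]

theorem laverage_add_right {α : Type*} [MeasurableSpace α] {μ : Measure α}
    (F : α → ℝ≥0∞) {G : α → ℝ≥0∞} (hG : AEMeasurable G μ) :
    ⨍⁻ w, (F w + G w) ∂μ = ⨍⁻ w, F w ∂μ + ⨍⁻ w, G w ∂μ := by
  rw [laverage_eq', laverage_eq', laverage_eq', lintegral_add_right' _ (hG.smul_measure _)]

theorem integrableOn_ball {g : Rn n → ℂ} (hg : LocallyIntegrable g) (z : Rn n) (r : ℝ) :
    IntegrableOn g (ball z r) :=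
  (hg.integrableOn_isCompact (isCompact_closedBall z r)).mono_set ball_subset_closedBall

theorem enorm_average_sub_le {g : Rn n → ℂ} {z : Rn n} {r : ℝ} (hr : 0 < r)
    (hg : IntegrableOn g (ball z r)) (c : ℂ) :
    ‖(⨍ w in ball z r, g w ∂volume) - c‖ₑ ≤ ⨍⁻ w in ball z r, ‖g w - c‖ₑ ∂volume := by
  have h0 := volume_ball_pos z hr
  have h1 := volume_ball_ne_top z r
  have hc : IntegrableOn (fun _ : Rn n => c) (ball z r) := integrableOn_const h1
  have : (⨍ w in ball z r, g w ∂volume) - c = ⨍ w in ball z r, (g w - c) ∂volume := by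
    conv_lhs => rw [← setAverage_const h0 h1 c]
    simp only [setAverage_eq]
    rw [integral_sub hg hc, smul_sub]
  rw [this, average_eq', laverage_eq']
  exact enorm_integral_le_lintegral_enorm _

/-- The mean is itself within the average of `|g - c|` from `c`. This is what allows the commutator
to be estimated modulo a constant depending on the ball. -/
theorem meanOsc_le {g : Rn n → ℂ} {z : Rn n} {r : ℝ} (hr : 0 < r)
    (hg : IntegrableOn g (ball z r)) (c : ℂ) :
    meanOsc g z r ≤ 2 * ⨍⁻ w in ball z r, ‖g w - c‖ₑ ∂volume := by
  have h : ∀ y, ‖g y - ⨍ w in ball z r, g w ∂volume‖ₑ ≤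
      ‖g y - c‖ₑ + ‖(⨍ w in ball z r, g w ∂volume) - c‖ₑ := fun y => by
    have := enorm_sub_le (E := ℂ) (a := g y - c) (b := (⨍ w in ball z r, g w ∂volume) - c)
    simpa using this
  refine (laverage_mono_ae (Filter.Eventually.of_forall h)).trans ?_
  rw [laverage_add_right _ aemeasurable_const, laverage_ball_const _ z hr, two_mul]
  gcongr
  exact enorm_average_sub_le hr hg c

theorem enorm_average_sub_average_two_le {g : Rn n → ℂ} {z : Rn n} {r : ℝ} (hr : 0 < r)
    (hg : LocallyIntegrable g) :
    ‖(⨍ w in ball z r, g w ∂volume) - ⨍ w in ball z (2 * r), g w ∂volume‖ₑ ≤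
      2 ^ n * meanOsc g z (2 * r) :=
  (enorm_average_sub_le hr (integrableOn_ball hg z r) _).trans (laverage_ball_le_two _ z hr)

/-! ### Stopping balls and the John–Nirenberg inequality. -/

theorem ball_ae_eq_closedBall (z : Rn n) {r : ℝ} (hr : 0 < r) :
    ball z r =ᵐ[volume] closedBall z r := by
  refine ae_eq_of_subset_of_measure_ge ball_subset_closedBall ?_
    measurableSet_ball.nullMeasurableSet measure_closedBall_lt_top.ne
  rw [Measure.addHaar_closedBall volume z hr.le, Measure.addHaar_ball_of_pos volume z hr]

/-- Lebesgue differentiation along a geometric sequence of concentric balls. -/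
theorem ae_tendsto_laverage_ball {g : Rn n → ℂ} (hg : LocallyIntegrable g) {s : ℝ} (hs : 0 < s) :
    ∀ᵐ y, Filter.Tendsto (fun k : ℕ => ⨍⁻ w in ball y (s / 5 ^ k), ‖g w‖ₑ ∂volume)
      Filter.atTop (nhds ‖g y‖ₑ) := by
  have hlim : Filter.Tendsto (fun k : ℕ => s / 5 ^ k) Filter.atTop (nhdsWithin 0 (Ioi 0)) := by
    refine tendsto_nhdsWithin_iff.2 ⟨?_, Filter.Eventually.of_forall fun k => ?_⟩
    · have := (tendsto_pow_atTop_nhds_zero_of_lt_one (r := (1 / 5 : ℝ)) (by norm_num)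
        (by norm_num)).const_mul s
      simpa [div_eq_mul_inv] using this
    · exact mem_Ioi.2 (by positivity)
  have hg' : LocallyIntegrable (fun w => ‖g w‖) := fun x => (hg x).norm
  filter_upwards [IsUnifLocDoublingMeasure.ae_tendsto_average volume
    (f := fun w => ‖g w‖) hg' 1] with y hy
  have h := hy (fun _ : ℕ => y) (fun k : ℕ => s / 5 ^ k) hlim
    (Filter.Eventually.of_forall fun k => mem_closedBall_self (by positivity))
  have h2 := (ENNReal.continuous_ofReal.tendsto _).comp h
  rw [ofReal_norm] at h2
  refine h2.congr fun k => ?_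
  have hk : 0 < s / 5 ^ k := by positivity
  have hi : IntegrableOn (fun w => ‖g w‖) (closedBall y (s / 5 ^ k)) :=
    (hg'.integrableOn_isCompact (isCompact_closedBall _ _))
  rw [Function.comp_apply, ofReal_setAverage hi (Filter.Eventually.of_forall fun w => norm_nonneg _),
    laverage_ball_eq, ← measure_congr (ball_ae_eq_closedBall y hk),
    ← Measure.restrict_congr_set (ball_ae_eq_closedBall y hk)]
  simp only [ofReal_norm]

/-- A Calderón–Zygmund type stopping time covering of a ball by balls. -/
theorem exists_stopping_balls {g : Rn n → ℂ} (hg : LocallyIntegrable g) {z : Rn n} {s : ℝ}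
    (hs : 0 < s) {α : ℝ≥0∞}
    (hα : ∀ x ∈ ball z s, ⨍⁻ w in ball x s, ‖g w‖ₑ ∂volume ≤ α) :
    ∃ (u : Set (Rn n)) (R : Rn n → ℝ), u.Countable ∧
      (∀ x ∈ u, 0 < R x ∧ 5 * R x ≤ s ∧ ⨍⁻ w in ball x (5 * R x), ‖g w‖ₑ ∂volume ≤ α) ∧
      (∀ᵐ y, y ∈ ball z s → α < ‖g y‖ₑ → ∃ x ∈ u, y ∈ ball x (5 * R x)) ∧
      α * ∑' x : u, volume (ball (x : Rn n) (5 * R x)) ≤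
        5 ^ n * ∫⁻ w in ball z (2 * s), ‖g w‖ₑ := by
  set T : Set (Rn n) := {y | y ∈ ball z s ∧ α < ‖g y‖ₑ ∧
    Filter.Tendsto (fun k : ℕ => ⨍⁻ w in ball y (s / 5 ^ k), ‖g w‖ₑ ∂volume)
      Filter.atTop (nhds ‖g y‖ₑ)} with hT
  have key : ∀ y, ∃ r : ℝ, y ∈ T → 0 < r ∧ 5 * r ≤ s ∧
      ⨍⁻ w in ball y (5 * r), ‖g w‖ₑ ∂volume ≤ α ∧ α < ⨍⁻ w in ball y r, ‖g w‖ₑ ∂volume := by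
    intro y
    by_cases hy : y ∈ T
    swap
    · exact ⟨0, fun h => absurd h hy⟩
    classical
    -- Stop at the first radius `s / 5^k` whose average exceeds `α`; `hα` excludes `k = 0`. The
    -- ratio 5 equals the Vitali enlargement factor, so the enlarged ball is the preceding stage and
    -- still has average at most `α`.
    have hex : ∃ k : ℕ, α < ⨍⁻ w in ball y (s / 5 ^ k), ‖g w‖ₑ ∂volume :=
      (hy.2.2.eventually (lt_mem_nhds hy.2.1)).exists
    obtain ⟨k, hk⟩ : ∃ k, Nat.find hex = k := ⟨_, rfl⟩
    have h1 := Nat.find_spec hex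
    rw [hk] at h1
    cases k with
    | zero => exact absurd h1 (not_lt.2 (by simpa using hα y hy.1))
    | succ k =>
      have h2 := Nat.find_min hex (m := k) (by omega)
      have h3 : 5 * (s / 5 ^ (k + 1)) = s / 5 ^ k := by
        rw [pow_succ]; field_simp
      refine ⟨s / 5 ^ (k + 1), fun _ => ⟨by positivity, ?_, ?_, h1⟩⟩
      · rw [h3]; exact div_le_self hs.le (one_le_pow₀ (by norm_num))
      · rw [h3]; exact not_lt.1 h2
  choose R hR using key
  obtain ⟨u, huT, hdisj, hcov⟩ := Vitali.exists_disjoint_subfamily_covering_enlargement_closedBall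
    T (fun x => x) R s (fun a ha => by have := hR a ha; linarith [this.1, this.2.1]) 5 (by norm_num)
  have hdisj' : u.PairwiseDisjoint fun a => ball a (R a) :=
    fun a ha c hc hac => (hdisj ha hc hac).mono ball_subset_closedBall ball_subset_closedBall
  have hcount : u.Countable := hdisj'.countable_of_isOpen (fun _ _ => isOpen_ball)
    (fun a ha => ⟨a, mem_ball_self (hR a (huT ha)).1⟩)
  refine ⟨u, R, hcount, fun x hx => ⟨(hR x (huT hx)).1, (hR x (huT hx)).2.1,
    (hR x (huT hx)).2.2.1⟩, ?_, ?_⟩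
  · filter_upwards [ae_tendsto_laverage_ball hg hs] with y hy h1 h2
    have hyT : y ∈ T := ⟨h1, h2, hy⟩
    obtain ⟨x, hxu, hx⟩ := hcov y hyT
    refine ⟨x, hxu, ?_⟩
    -- Vitali covers only by closed balls, but a whole ball around `y` lies in the enlarged one, so
    -- `y` is interior to it.
    have h5 : 5 * R x ≠ 0 := by have := (hR x (huT hxu)).1; positivity
    rw [← interior_closedBall x h5]
    exact interior_maximal (ball_subset_closedBall.trans hx) isOpen_ball
      (mem_ball_self (hR y hyT).1)
  -- The unenlarged balls are disjoint, have average above `α`, and lie in `B(z, 2s)`; enlarging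
  -- costs `5^n` in volume.
  · have := hcount.to_subtype
    have h1 : ∀ x : u, α * volume (ball (x : Rn n) (5 * R x)) ≤
        5 ^ n * ∫⁻ w in ball (x : Rn n) (R x), ‖g w‖ₑ := fun x => by
      rw [volume_ball_mul (x : Rn n) x (by norm_num), ENNReal.ofReal_pow (by norm_num),
        ENNReal.ofReal_ofNat, mul_left_comm, ← volume_mul_laverage_ball, mul_comm α]
      gcongr
      exact (hR x (huT x.2)).2.2.2.le
    rw [← ENNReal.tsum_mul_left]
    refine (ENNReal.tsum_le_tsum h1).trans ?_
    rw [ENNReal.tsum_mul_left]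
    gcongr
    rw [← lintegral_iUnion (fun x : u => measurableSet_ball)
      (fun a c hac => hdisj' a.2 c.2 (fun h => hac (Subtype.ext h)))]
    refine lintegral_mono_set (iUnion_subset fun x => ?_)
    have hx := hR x (huT x.2)
    refine ball_subset_ball' ?_
    have := mem_ball.1 (huT x.2).1
    linarith [hx.1, hx.2.1]

/-- If the proportion of each ball of radius at most `r` on which `b` deviates from its mean by
more than `t` is at most `θ`, then raising the level `t` by a multiple of the mean oscillation
halves that proportion. -/
theorem volume_deviation_le_half {b : Rn n → ℂ} (hb : LocallyIntegrable b) {r : ℝ} {A : ℝ≥0∞}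
    (hA0 : A ≠ 0) (hA1 : A ≠ ∞) (hA : ∀ z s, 0 < s → s ≤ 2 * r → meanOsc b z s ≤ A) {t θ : ℝ≥0∞}
    (h : ∀ z s, 0 < s → s ≤ r →
      volume {y | y ∈ ball z s ∧ t < ‖b y - ⨍ w in ball z s, b w ∂volume‖ₑ} ≤
        θ * volume (ball z s)) {z : Rn n} {s : ℝ} (hs : 0 < s) (hsr : s ≤ r) :
    volume {y | y ∈ ball z s ∧
        t + (2 * 10 ^ n + 2 ^ n) * A < ‖b y - ⨍ w in ball z s, b w ∂volume‖ₑ} ≤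
      θ / 2 * volume (ball z s) := by
  set c := ⨍ w in ball z (2 * s), b w ∂volume with hc
  have hAz := hA z (2 * s) (by linarith) (by linarith)
  have hg : LocallyIntegrable (fun y => b y - c) := hb.sub (locallyIntegrable_const c)
  -- The average is really at most `2^n A`. The larger threshold `2 · 10^n A` makes the enlarged
  -- stopping balls fill at most half of `B(z,s)`: `5^n` from Vitali, `2^n` from doubling, 2 for the
  -- half.
  have hα : ∀ x ∈ ball z s, ⨍⁻ w in ball x s, ‖b w - c‖ₑ ∂volume ≤ 2 * 10 ^ n * A := by
    intro x hx
    have hsub : ball x s ⊆ ball z (2 * s) :=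
      ball_subset_ball' (by have := mem_ball.1 hx; linarith)
    have h1 := laverage_ball_le_of_subset (fun w => ‖b w - c‖ₑ) two_pos hsub
    rw [ENNReal.ofReal_pow zero_le_two, ENNReal.ofReal_ofNat] at h1
    calc _ ≤ 2 ^ n * meanOsc b z (2 * s) := h1
      _ ≤ 10 ^ n * A := by gcongr; norm_num
      _ ≤ 2 * 10 ^ n * A := by
        gcongr
        exact le_mul_of_one_le_left zero_le one_le_two
  obtain ⟨u, R, hu, hR, hcov, hsum⟩ := exists_stopping_balls hg hs hα
  have hcu := hu.to_subtype
  have hsum2 : 2 * ∑' x : u, volume (ball (x : Rn n) (5 * R x)) ≤ volume (ball z s) := by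
    have h1 : ∫⁻ w in ball z (2 * s), ‖b w - c‖ₑ ≤ A * (2 ^ n * volume (ball z s)) := by
      have h2 := volume_ball_mul z z two_pos s
      rw [ENNReal.ofReal_pow zero_le_two, ENNReal.ofReal_ofNat] at h2
      rw [← volume_mul_laverage_ball, h2, mul_comm]
      gcongr
      exact hAz
    have h3 : (10 ^ n * A) * (2 * ∑' x : u, volume (ball (x : Rn n) (5 * R x))) ≤
        (10 ^ n * A) * volume (ball z s) := by
      calc _ = 2 * 10 ^ n * A * ∑' x : u, volume (ball (x : Rn n) (5 * R x)) := by ring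
        _ ≤ 5 ^ n * (A * (2 ^ n * volume (ball z s))) := hsum.trans (by gcongr)
        _ = (5 * 2) ^ n * A * volume (ball z s) := by rw [mul_pow]; ring
        _ = _ := by norm_num
    refine (ENNReal.mul_le_mul_iff_right ?_ ?_).1 h3
    · exact mul_ne_zero (by positivity) hA0
    · exact ENNReal.mul_ne_top (ENNReal.pow_ne_top (by norm_num)) hA1
  have hmeas : volume {y | y ∈ ball z s ∧
        t + (2 * 10 ^ n + 2 ^ n) * A < ‖b y - ⨍ w in ball z s, b w ∂volume‖ₑ} ≤
      ∑' x : u, θ * volume (ball (x : Rn n) (5 * R x)) := by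
    refine le_trans ?_ ((measure_iUnion_le fun x : u => {y | y ∈ ball (x : Rn n) (5 * R x) ∧
      t < ‖b y - ⨍ w in ball (x : Rn n) (5 * R x), b w ∂volume‖ₑ}).trans
      (ENNReal.tsum_le_tsum fun x => h x _ (by linarith [(hR x x.2).1])
        (by linarith [(hR x x.2).2.1])))
    refine measure_mono_ae ?_
    filter_upwards [hcov] with y hy hyS
    obtain ⟨hyB, hyt⟩ := hyS
    have h1 : t + 2 * 10 ^ n * A < ‖b y - c‖ₑ := by
      by_contra! hcon
      refine absurd hyt (not_lt.2 ?_)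
      have h2 := enorm_average_sub_average_two_le hs hb (z := z)
      calc ‖b y - ⨍ w in ball z s, b w ∂volume‖ₑ
          ≤ ‖b y - c‖ₑ + ‖(⨍ w in ball z s, b w ∂volume) - c‖ₑ := by
            simpa using enorm_sub_le (E := ℂ) (a := b y - c)
              (b := (⨍ w in ball z s, b w ∂volume) - c)
        _ ≤ (t + 2 * 10 ^ n * A) + 2 ^ n * A :=
            add_le_add hcon (h2.trans (by gcongr))
        _ = _ := by ring
    -- On a stopping ball the mean of `b` is within the threshold of `c`, so `y` still deviates by
    -- more than `t` from that mean, and `h` applies to the stopping ball.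
    obtain ⟨x, hxu, hx⟩ := hy hyB (lt_of_le_of_lt le_add_self h1)
    refine mem_iUnion.2 ⟨⟨x, hxu⟩, hx, ?_⟩
    by_contra! hcon
    refine absurd h1 (not_lt.2 ?_)
    have h2 := (enorm_average_sub_le (by linarith [(hR x hxu).1])
      (integrableOn_ball hb x (5 * R x)) c).trans (hR x hxu).2.2
    calc ‖b y - c‖ₑ ≤ ‖b y - ⨍ w in ball x (5 * R x), b w ∂volume‖ₑ +
          ‖(⨍ w in ball x (5 * R x), b w ∂volume) - c‖ₑ := by
            simpa using enorm_add_le (b y - ⨍ w in ball x (5 * R x), b w ∂volume)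
              ((⨍ w in ball x (5 * R x), b w ∂volume) - c)
      _ ≤ _ := add_le_add hcon h2
  refine hmeas.trans ?_
  rw [ENNReal.tsum_mul_left, ENNReal.div_eq_inv_mul, mul_comm _ θ, mul_assoc]
  gcongr
  rw [← ENNReal.div_eq_inv_mul, ENNReal.le_div_iff_mul_le (by simp) (by simp), mul_comm]
  exact hsum2

/-- Iterates the halving step, starting from the trivial proportion 1 at level 0. -/
theorem volume_deviation_le_geometric {b : Rn n → ℂ} (hb : LocallyIntegrable b) {r : ℝ} {A : ℝ≥0∞}
    (hA0 : A ≠ 0) (hA1 : A ≠ ∞) (hA : ∀ z s, 0 < s → s ≤ 2 * r → meanOsc b z s ≤ A) (m : ℕ) :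
    ∀ z s, 0 < s → s ≤ r →
      volume {y | y ∈ ball z s ∧
        m * ((2 * 10 ^ n + 2 ^ n) * A) < ‖b y - ⨍ w in ball z s, b w ∂volume‖ₑ} ≤
        2⁻¹ ^ m * volume (ball z s) := by
  induction m with
  | zero =>
    intro z s _ _
    rw [pow_zero, one_mul]
    exact measure_mono fun y hy => hy.1
  | succ m ih =>
    intro z s hs hsr
    have := volume_deviation_le_half hb hA0 hA1 hA ih hs hsr (z := z)
    rwa [← add_one_mul, ← Nat.cast_succ, div_eq_mul_inv, ← pow_succ] at this

/-- The constant `∑ (m + 1)ᵖ 2⁻ᵐ`. -/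
noncomputable def geomMoment (p : ℝ) : ℝ≥0∞ := ∑' m : ℕ, ((m + 1 : ℕ) : ℝ≥0∞) ^ p * 2⁻¹ ^ m

theorem geomMoment_ne_top (p : ℝ) : geomMoment p ≠ ∞ := by
  obtain ⟨k, hk⟩ := exists_nat_ge p
  have h1 : Summable fun m : ℕ => (((m + 1 : ℕ) : ℝ≥0) ^ k * 2⁻¹ ^ m : ℝ≥0) := by
    have h2 := summable_pow_mul_geometric_of_norm_lt_one (R := ℝ) k (r := 2⁻¹) (by norm_num)
    have h3 := ((summable_nat_add_iff 1).2 h2).mul_right 2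
    refine NNReal.summable_coe.1 (h3.congr fun m => ?_)
    push_cast
    rw [pow_succ]
    ring
  have h2 := ENNReal.tsum_coe_ne_top_iff_summable.2 h1
  refine ne_top_of_le_ne_top h2 (ENNReal.tsum_le_tsum fun m => ?_)
  push_cast
  gcongr
  rw [← ENNReal.rpow_natCast]
  refine ENNReal.rpow_le_rpow_of_exponent_le ?_ hk
  exact le_add_self

/-- Slice the values of the deviation into layers between consecutive multiples of `a`; geometric
decay of the level sets beats the polynomial weights. Layers of positive width require `A ≠ 0`. -/
theorem lintegral_deviation_rpow_le {b : Rn n → ℂ} (hb : LocallyIntegrable b) {r p : ℝ} (hp : 0 < p)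
    {A : ℝ≥0∞} (hA0 : A ≠ 0) (hA1 : A ≠ ∞)
    (hA : ∀ z s, 0 < s → s ≤ 2 * r → meanOsc b z s ≤ A) {z : Rn n} {s : ℝ} (hs : 0 < s)
    (hsr : s ≤ r) :
    ⨍⁻ y in ball z s, ‖b y - ⨍ w in ball z s, b w ∂volume‖ₑ ^ p ∂volume ≤
      geomMoment p * ((2 * 10 ^ n + 2 ^ n) * A) ^ p := by
  set a : ℝ≥0∞ := (2 * 10 ^ n + 2 ^ n) * A with ha
  set G : Rn n → ℝ≥0∞ := fun y => ‖b y - ⨍ w in ball z s, b w ∂volume‖ₑ with hG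
  have hGm : AEMeasurable G := (hb.aestronglyMeasurable.sub aestronglyMeasurable_const).enorm
  have ha0 : a ≠ 0 := mul_ne_zero (by positivity) hA0
  have ha1 : a ≠ ∞ := ENNReal.mul_ne_top (by finiteness) hA1
  have hpt : ∀ y, G y ^ p ≤
      ∑' m : ℕ, {y | m * a < G y}.indicator (fun _ => ((m + 1 : ℕ) * a) ^ p) y := by
    intro y
    rcases eq_or_ne (G y) 0 with h0 | h0
    · rw [h0, ENNReal.zero_rpow_of_pos hp]; exact zero_le
    classical
    have hex : ∃ m : ℕ, G y ≤ m * a := by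
      obtain ⟨m, hm⟩ := ENNReal.exists_nat_mul_gt ha0 (enorm_ne_top : G y ≠ ∞)
      exact ⟨m, hm.le⟩
    obtain ⟨k, hk⟩ : ∃ k, Nat.find hex = k := ⟨_, rfl⟩
    have h1 := Nat.find_spec hex
    rw [hk] at h1
    cases k with
    | zero => simp at h1; exact absurd h1 h0
    | succ k =>
      have h2 := not_le.1 (Nat.find_min hex (m := k) (by omega))
      refine le_trans ?_ (ENNReal.le_tsum k)
      rw [indicator_of_mem (show y ∈ {y | k * a < G y} from h2)]
      gcongr
  rw [laverage_ball_eq]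
  refine ENNReal.div_le_of_le_mul ?_
  have hms : ∀ m : ℕ, NullMeasurableSet {y | m * a < G y} := fun m =>
    nullMeasurableSet_lt aemeasurable_const hGm
  calc ∫⁻ y in ball z s, G y ^ p
      ≤ ∫⁻ y in ball z s, ∑' m : ℕ,
          {y | m * a < G y}.indicator (fun _ => ((m + 1 : ℕ) * a) ^ p) y :=
        lintegral_mono hpt
    _ = ∑' m : ℕ, ∫⁻ y in ball z s,
          {y | m * a < G y}.indicator (fun _ => ((m + 1 : ℕ) * a) ^ p) y :=
        lintegral_tsum fun m => (aemeasurable_const.indicator₀ (hms m)).restrict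
    _ ≤ ∑' m : ℕ, ((m + 1 : ℕ) * a) ^ p * (2⁻¹ ^ m * volume (ball z s)) := by
        refine ENNReal.tsum_le_tsum fun m => ?_
        rw [lintegral_indicator_const₀ ((hms m).mono_ac Measure.restrict_le_self.absolutelyContinuous),
          Measure.restrict_apply₀' measurableSet_ball.nullMeasurableSet]
        gcongr
        refine le_trans (measure_mono ?_) (volume_deviation_le_geometric hb hA0 hA1 hA m z s hs hsr)
        exact fun y hy => ⟨hy.2, hy.1⟩
    _ = geomMoment p * a ^ p * volume (ball z s) := by
        rw [geomMoment, ← ENNReal.tsum_mul_right, ← ENNReal.tsum_mul_right]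
        refine tsum_congr fun m => ?_
        rw [ENNReal.mul_rpow_of_nonneg _ _ hp.le]
        ring

/-- **John–Nirenberg inequality**, in `Lᵖ` form. -/
theorem laverage_deviation_rpow_le {b : Rn n → ℂ} (hb : LocallyIntegrable b) {r p : ℝ} (hp : 0 < p)
    {A : ℝ≥0∞} (hA1 : A ≠ ∞)
    (hA : ∀ z s, 0 < s → s ≤ 2 * r → meanOsc b z s ≤ A) {z : Rn n} {s : ℝ} (hs : 0 < s)
    (hsr : s ≤ r) :
    (⨍⁻ y in ball z s, ‖b y - ⨍ w in ball z s, b w ∂volume‖ₑ ^ p ∂volume) ^ (1 / p) ≤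
      geomMoment p ^ (1 / p) * (2 * 10 ^ n + 2 ^ n) * A := by
  -- `A` may vanish, so the bound is applied with `A + δ` and `δ` tends to 0.
  have hK : ∀ δ : ℝ≥0, 0 < δ →
      (⨍⁻ y in ball z s, ‖b y - ⨍ w in ball z s, b w ∂volume‖ₑ ^ p ∂volume) ^ (1 / p) ≤
      geomMoment p ^ (1 / p) * (2 * 10 ^ n + 2 ^ n) * (A + δ) := by
    intro δ hδ
    have h := lintegral_deviation_rpow_le hb hp (A := A + δ) (by simp [hδ.ne'])
      (by finiteness) (fun z s h1 h2 => (hA z s h1 h2).trans le_self_add) hs hsr (z := z)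
    calc _ ≤ (geomMoment p * ((2 * 10 ^ n + 2 ^ n) * (A + δ)) ^ p) ^ (1 / p) := by
          gcongr
      _ = _ := by
        rw [ENNReal.mul_rpow_of_nonneg _ _ (by positivity), ← ENNReal.rpow_mul,
          mul_one_div_cancel hp.ne', ENNReal.rpow_one]
        ring
  have hfin : geomMoment p ^ (1 / p) * (2 * 10 ^ n + 2 ^ n) ≠ ∞ :=
    ENNReal.mul_ne_top (ENNReal.rpow_ne_top_of_nonneg (by positivity) (geomMoment_ne_top p))
      (by finiteness)
  have hlim : Filter.Tendsto (fun δ : ℝ≥0 => geomMoment p ^ (1 / p) * (2 * 10 ^ n + 2 ^ n) *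
      (A + (δ : ℝ≥0∞))) (nhdsWithin 0 (Ioi 0))
      (nhds (geomMoment p ^ (1 / p) * (2 * 10 ^ n + 2 ^ n) * (A + ((0 : ℝ≥0) : ℝ≥0∞)))) := by
    refine Filter.Tendsto.mono_left ?_ nhdsWithin_le_nhds
    refine ENNReal.Tendsto.const_mul ?_ (Or.inr hfin)
    exact (ENNReal.continuous_coe.tendsto 0).const_add A
  have := ge_of_tendsto hlim (by filter_upwards [self_mem_nhdsWithin] with δ hδ using hK δ hδ)
  simpa using this

/-! ### Hölder estimates with Campanato functions. -/

theorem meanOsc_le_mul_campanatoNorm {ψ : ℝ → ℝ} (hψpos : ∀ r : ℝ, 0 < r → 0 < ψ r) (b : Rn n → ℂ)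
    (z : Rn n) {s : ℝ} (hs : 0 < s) :
    meanOsc b z s ≤ ENNReal.ofReal (ψ s) * campanatoNorm ψ b := by
  have h : (ENNReal.ofReal (ψ s))⁻¹ * meanOsc b z s ≤ campanatoNorm ψ b :=
    le_iSup_of_le z (le_iSup_of_le s (le_iSup_of_le hs le_rfl))
  rwa [mul_comm, ← div_eq_mul_inv, ENNReal.div_le_iff
    (by simpa using hψpos s hs) ENNReal.ofReal_ne_top, mul_comm] at h

theorem AlmostIncreasing.exists_ofReal_le {ψ : ℝ → ℝ} (hψ : AlmostIncreasing ψ) :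
    ∃ D : ℝ≥0∞, D ≠ ∞ ∧ ∀ r s : ℝ, 0 < r → r ≤ s →
      ENNReal.ofReal (ψ r) ≤ D * ENNReal.ofReal (ψ s) := by
  obtain ⟨C, hC, h⟩ := hψ
  refine ⟨max 1 (ENNReal.ofReal C), by simp, fun r s hr hrs => ?_⟩
  rcases hrs.eq_or_lt with rfl | hlt
  · exact le_mul_of_one_le_left zero_le (le_max_left _ _)
  · calc ENNReal.ofReal (ψ r) ≤ ENNReal.ofReal (C * ψ s) := ENNReal.ofReal_le_ofReal (h r s hr hlt)
      _ = ENNReal.ofReal C * ENNReal.ofReal (ψ s) := ENNReal.ofReal_mul hC.le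
      _ ≤ _ := by gcongr; exact le_max_right _ _

theorem laverage_mul_le {α : Type*} [MeasurableSpace α] {μ : Measure α} {p q : ℝ}
    (hpq : p.HolderConjugate q) {F G : α → ℝ≥0∞} (hF : AEMeasurable F μ) (hG : AEMeasurable G μ) :
    ⨍⁻ w, F w * G w ∂μ ≤ (⨍⁻ w, F w ^ p ∂μ) ^ (1 / p) * (⨍⁻ w, G w ^ q ∂μ) ^ (1 / q) := by
  simp only [laverage_eq']
  exact ENNReal.lintegral_mul_le_Lp_mul_Lq _ hpq (hF.smul_measure _) (hG.smul_measure _)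

theorem laverage_ball_rpow_le_two {q : ℝ} (hq : 1 ≤ q) (G : Rn n → ℝ≥0∞) (z : Rn n) {s : ℝ}
    (hs : 0 < s) :
    (⨍⁻ w in ball z s, G w ∂volume) ^ (1 / q) ≤
      2 ^ n * (⨍⁻ w in ball z (2 * s), G w ∂volume) ^ (1 / q) := by
  have hq0 : 0 < q := by linarith
  calc _ ≤ (2 ^ n * ⨍⁻ w in ball z (2 * s), G w ∂volume) ^ (1 / q) := by
        gcongr; exact laverage_ball_le_two G z hs
    _ = ((2 : ℝ≥0∞) ^ n) ^ (1 / q) * (⨍⁻ w in ball z (2 * s), G w ∂volume) ^ (1 / q) :=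
        ENNReal.mul_rpow_of_nonneg _ _ (by positivity)
    _ ≤ _ := by
        gcongr
        conv_rhs => rw [← ENNReal.rpow_one ((2 : ℝ≥0∞) ^ n)]
        exact ENNReal.rpow_le_rpow_of_exponent_le (one_le_pow₀ one_le_two)
          ((div_le_one hq0).2 hq)

/-- Telescopes over `j` doublings, each costing `2^n A`. -/
theorem enorm_average_sub_average_pow_two_le {b : Rn n → ℂ} (hb : LocallyIntegrable b)
    {z : Rn n} {s : ℝ} (hs : 0 < s) {A : ℝ≥0∞} (j : ℕ)
    (hA : ∀ t, 0 < t → t ≤ 2 ^ j * s → meanOsc b z t ≤ A) :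
    ‖(⨍ w in ball z (2 ^ j * s), b w ∂volume) - ⨍ w in ball z s, b w ∂volume‖ₑ ≤
      j * (2 ^ n * A) := by
  induction j with
  | zero => simp
  | succ j ih =>
    have hj : 0 < 2 ^ j * s := by positivity
    have h2 : 2 * (2 ^ j * s) = 2 ^ (j + 1) * s := by ring
    have h1 := enorm_average_sub_average_two_le hj hb (z := z)
    rw [h2] at h1
    have h3 := h1.trans (mul_le_mul_right (hA (2 ^ (j + 1) * s) (by positivity) le_rfl) _)
    have h4 := ih fun t ht htj => hA t ht (by linarith)
    have h5 := enorm_sub_le (E := ℂ)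
      (a := (⨍ w in ball z (2 ^ j * s), b w ∂volume) - ⨍ w in ball z s, b w ∂volume)
      (b := (⨍ w in ball z (2 ^ j * s), b w ∂volume) -
        ⨍ w in ball z (2 ^ (j + 1) * s), b w ∂volume)
    rw [sub_sub_sub_cancel_left] at h5
    refine h5.trans ((add_le_add h4 h3).trans ?_)
    push_cast
    rw [add_one_mul]

/-- Hölder's inequality combined with the John–Nirenberg inequality: the mean of
`|b - b_B| |g|` over a dilate of `B`. -/
theorem exists_laverage_deviation_mul_le {ψ : ℝ → ℝ} (hψpos : ∀ r : ℝ, 0 < r → 0 < ψ r)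
    (hψ : AlmostIncreasing ψ) {η : ℝ} (hη : 1 < η) :
    ∃ C : ℝ≥0∞, C ≠ ∞ ∧ ∀ b : Rn n → ℂ, MemCampanato ψ b →
      ∀ g : Rn n → ℂ, AEStronglyMeasurable g → ∀ (z : Rn n) (s : ℝ) (j : ℕ), 0 < s →
      ⨍⁻ y in ball z (2 ^ j * s), ‖b y - ⨍ w in ball z s, b w ∂volume‖ₑ * ‖g y‖ₑ ∂volume ≤
        C * (j + 1) * campanatoNorm ψ b * (ENNReal.ofReal (ψ (2 ^ (j + 1) * s)) *
          (⨍⁻ y in ball z (2 ^ (j + 1) * s), ‖g y‖ₑ ^ η ∂volume) ^ (1 / η)) := by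
  obtain ⟨D, hD, hDψ⟩ := hψ.exists_ofReal_le
  have hpq : η.conjExponent.HolderConjugate η := (Real.HolderConjugate.conjExponent hη).symm
  set p := η.conjExponent with hp
  have hp0 : 0 < p := hpq.pos
  set K : ℝ≥0∞ := geomMoment p ^ (1 / p) * (2 * 10 ^ n + 2 ^ n) with hKdef
  have hK : K ≠ ∞ :=
    ENNReal.mul_ne_top (ENNReal.rpow_ne_top_of_nonneg (by positivity) (geomMoment_ne_top p))
      (by finiteness)
  refine ⟨(K + 2 ^ n) * D * 2 ^ n, by finiteness, fun b hb g hg z s j hs => ?_⟩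
  set N := campanatoNorm ψ b with hN
  set W := ENNReal.ofReal (ψ (2 ^ (j + 1) * s)) with hW
  set Y := (⨍⁻ y in ball z (2 ^ (j + 1) * s), ‖g y‖ₑ ^ η ∂volume) ^ (1 / η) with hY
  -- Almost monotonicity of `ψ` makes this one number bound the oscillation on all balls of radius
  -- at most `2^(j+1) s`. John–Nirenberg at radius `2^j s` looks at balls twice as large, hence the
  -- exponent `j + 1`.
  set A : ℝ≥0∞ := D * W * N with hAdef
  have hN1 : N ≠ ∞ := hb.2.ne
  have hA1 : A ≠ ∞ := ENNReal.mul_ne_top (ENNReal.mul_ne_top hD ENNReal.ofReal_ne_top) hN1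
  have hj : 0 < 2 ^ j * s := by positivity
  have h2 : 2 * (2 ^ j * s) = 2 ^ (j + 1) * s := by ring
  have hA : ∀ z t, 0 < t → t ≤ 2 * (2 ^ j * s) → meanOsc b z t ≤ A := fun z t ht htj =>
    (meanOsc_le_mul_campanatoNorm hψpos b z ht).trans
      (mul_le_mul_left (hDψ t _ ht (h2 ▸ htj)) _)
  set β := ⨍ w in ball z (2 ^ j * s), b w ∂volume with hβ
  set c := ⨍ w in ball z s, b w ∂volume with hc
  have hbm : ∀ d : ℂ, AEMeasurable (fun y => ‖b y - d‖ₑ) (volume.restrict (ball z (2 ^ j * s))) :=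
    fun d => (hb.1.aestronglyMeasurable.sub aestronglyMeasurable_const).enorm.restrict
  have hgm : AEMeasurable (fun y => ‖g y‖ₑ) (volume.restrict (ball z (2 ^ j * s))) :=
    hg.enorm.restrict
  have hYle : (⨍⁻ y in ball z (2 ^ j * s), ‖g y‖ₑ ^ η ∂volume) ^ (1 / η) ≤ 2 ^ n * Y := by
    have := laverage_ball_rpow_le_two hη.le (fun y => ‖g y‖ₑ ^ η) z hj
    rwa [h2] at this
  have hmain : ⨍⁻ y in ball z (2 ^ j * s), ‖b y - β‖ₑ * ‖g y‖ₑ ∂volume ≤ K * A * (2 ^ n * Y) := by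
    refine (laverage_mul_le hpq (hbm β) hgm).trans ?_
    gcongr
    exact laverage_deviation_rpow_le hb.1 hp0 hA1 hA hj le_rfl
  have hmean : ⨍⁻ y in ball z (2 ^ j * s), ‖g y‖ₑ ∂volume ≤ 2 ^ n * Y := by
    have h := laverage_mul_le hpq (F := fun _ => 1) aemeasurable_const hgm
    simp only [one_mul, ENNReal.one_rpow] at h
    rw [laverage_ball_const 1 z hj, ENNReal.one_rpow, one_mul] at h
    exact h.trans hYle
  have hdiff : ‖β - c‖ₑ ≤ j * (2 ^ n * A) :=
    enorm_average_sub_average_pow_two_le hb.1 hs j fun t ht htj => hA z t ht (by linarith)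
  have hpt : ∀ y, ‖b y - c‖ₑ * ‖g y‖ₑ ≤ ‖b y - β‖ₑ * ‖g y‖ₑ + ‖β - c‖ₑ * ‖g y‖ₑ := fun y => by
    rw [← add_mul]
    gcongr
    simpa using enorm_add_le (b y - β) (β - c)
  calc _ ≤ ⨍⁻ y in ball z (2 ^ j * s), (‖b y - β‖ₑ * ‖g y‖ₑ + ‖β - c‖ₑ * ‖g y‖ₑ) ∂volume :=
        laverage_mono_ae (Filter.Eventually.of_forall hpt)
    _ = ⨍⁻ y in ball z (2 ^ j * s), ‖b y - β‖ₑ * ‖g y‖ₑ ∂volume +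
        ‖β - c‖ₑ * ⨍⁻ y in ball z (2 ^ j * s), ‖g y‖ₑ ∂volume := by
        rw [laverage_add_right _ (hgm.const_mul _), laverage_const_mul enorm_ne_top]
    _ ≤ K * A * (2 ^ n * Y) + j * (2 ^ n * A) * (2 ^ n * Y) := by gcongr
    _ ≤ (j + 1) * (K * A * (2 ^ n * Y)) + (j + 1) * ((2 ^ n * A) * (2 ^ n * Y)) := by
        refine add_le_add (le_mul_of_one_le_left zero_le le_add_self) ?_
        rw [mul_assoc]
        gcongr
        exact le_self_add
    _ = _ := by rw [hAdef]; ring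

theorem mul_laverage_rpow_le_fracMaximal {w : ℝ → ℝ} {η : ℝ} (hη : 0 < η) {v : Rn n → ℂ}
    {x z : Rn n} {s : ℝ} (hs : 0 < s) (hx : x ∈ ball z s) (hw : 0 ≤ w s) :
    ENNReal.ofReal (w s) * (⨍⁻ y in ball z s, ‖v y‖ₑ ^ η ∂volume) ^ (1 / η) ≤
      (fracMaximal (fun r => w r ^ η) (fun y => ‖v y‖ ^ η) x) ^ (1 / η) := by
  have h : ENNReal.ofReal (w s ^ η) * ⨍⁻ y in ball z s, ‖‖v y‖ ^ η‖ₑ ∂volume ≤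
      fracMaximal (fun r => w r ^ η) (fun y => ‖v y‖ ^ η) x :=
    le_iSup_of_le z (le_iSup_of_le s (le_iSup_of_le hs (le_iSup_of_le hx le_rfl)))
  have h2 : ∀ y, ‖‖v y‖ ^ η‖ₑ = ‖v y‖ₑ ^ η := fun y => by
    rw [Real.enorm_eq_ofReal (by positivity), ← ENNReal.ofReal_rpow_of_nonneg (norm_nonneg _) hη.le,
      ofReal_norm]
  simp only [h2, ← ENNReal.ofReal_rpow_of_nonneg hw hη.le] at h
  refine le_trans (le_of_eq ?_) (ENNReal.rpow_le_rpow h (by positivity))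
  rw [ENNReal.mul_rpow_of_nonneg _ _ (by positivity), ← ENNReal.rpow_mul,
    mul_one_div_cancel hη.ne', ENNReal.rpow_one]

/-! ### The kernel and `ρ*`. -/

/-- The radial profile `ρ(t)/tⁿ` of the kernel. -/
noncomputable def kernel (n : ℕ) (ρ : ℝ → ℝ) (t : ℝ) : ℝ := ρ t / t ^ n

/-- With `r` fixed, the regularity condition is a Lipschitz estimate at `r`. Continuity then
supplies measurability of the kernel and integrability of `ρ(t)/t` away from 0. -/
theorem KernelRegularity.continuousOn_kernel {ρ : ℝ → ℝ} (h : KernelRegularity n ρ) :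
    ContinuousOn (kernel n ρ) (Ioi 0) := by
  obtain ⟨C, hC, h⟩ := h
  intro r hr
  have hr : 0 < r := hr
  refine ContinuousAt.continuousWithinAt ?_
  rw [ContinuousAt, tendsto_iff_norm_sub_tendsto_zero]
  have hlim : Filter.Tendsto (fun s => C * |r - s| * (rhoStar ρ r / r ^ (n + 1))) (nhds r)
      (nhds 0) := by
    have : Continuous fun s => C * |r - s| * (rhoStar ρ r / r ^ (n + 1)) := by fun_prop
    simpa using this.tendsto r
  refine squeeze_zero' (Filter.Eventually.of_forall fun _ => norm_nonneg _) ?_ hlim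
  filter_upwards [Ioo_mem_nhds (show r / 2 < r by linarith) (show r < 2 * r by linarith)]
    with s hs
  have hs0 : 0 < s := by linarith [hs.1]
  have := h r s hr hs0 (by rw [div_le_div_iff₀ two_pos hs0]; linarith [hs.2])
    (by rw [div_le_iff₀ hs0]; linarith [hs.1])
  rw [Real.norm_eq_abs, abs_sub_comm]
  exact this

theorem KernelRegularity.continuousOn {ρ : ℝ → ℝ} (h : KernelRegularity n ρ) :
    ContinuousOn ρ (Ioi 0) := by
  have h1 : ContinuousOn (fun t => kernel n ρ t * t ^ n) (Ioi 0) :=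
    h.continuousOn_kernel.mul (by fun_prop)
  refine h1.congr fun t ht => ?_
  have ht : t ≠ 0 := ne_of_gt ht
  exact (div_mul_cancel₀ (ρ t) (pow_ne_zero n ht)).symm

theorem measurable_kernel_norm {ρ : ℝ → ℝ} (h : KernelRegularity n ρ) :
    Measurable fun u : Rn n => kernel n ρ ‖u‖ := by
  refine measurable_of_continuousOn_compl_singleton 0 ?_
  exact h.continuousOn_kernel.comp continuous_norm.continuousOn
    fun u hu => norm_pos_iff.2 hu

theorem kernel_nonneg (hn : 0 < n) {ρ : ℝ → ℝ} (hρpos : ∀ r : ℝ, 0 < r → 0 < ρ r) {t : ℝ}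
    (ht : 0 ≤ t) : 0 ≤ kernel n ρ t := by
  rcases ht.eq_or_lt with rfl | ht
  -- Nothing is known about `ρ 0`; division by `0^n = 0` gives the value 0, which needs `n > 0`.
  · simp [kernel, hn.ne']
  · have := hρpos t ht
    rw [kernel]; positivity

theorem integrableOn_div_Ioc {ρ : ℝ → ℝ} (hρint : IntegrableOn (fun t : ℝ => ρ t / t) (Ioc 0 1))
    (h : KernelRegularity n ρ) (R : ℝ) : IntegrableOn (fun t : ℝ => ρ t / t) (Ioc 0 R) := by
  have h1 : IntegrableOn (fun t : ℝ => ρ t / t) (Icc 1 R) := by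
    refine ContinuousOn.integrableOn_compact isCompact_Icc ?_
    have hsub : Icc 1 R ⊆ Ioi (0 : ℝ) := fun t ht => lt_of_lt_of_le one_pos ht.1
    exact (h.continuousOn.mono hsub).div continuousOn_id fun t ht => ne_of_gt (hsub ht)
  refine (hρint.union h1).mono_set fun t ht => ?_
  rcases le_total t 1 with h2 | h2
  · exact Or.inl ⟨ht.1, h2⟩
  · exact Or.inr ⟨h2, ht.2⟩

theorem rhoStar_mono {ρ : ℝ → ℝ} (hρpos : ∀ r : ℝ, 0 < r → 0 < ρ r)
    (hint : ∀ R, IntegrableOn (fun t : ℝ => ρ t / t) (Ioc 0 R)) {r s : ℝ} (hr : 0 ≤ r)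
    (hrs : r ≤ s) : rhoStar ρ r ≤ rhoStar ρ s := by
  rw [rhoStar, rhoStar, intervalIntegral.integral_of_le hr,
    intervalIntegral.integral_of_le (hr.trans hrs)]
  refine setIntegral_mono_set (hint s) ?_ (Ioc_subset_Ioc_right hrs).eventuallyLE
  refine (ae_restrict_iff' measurableSet_Ioc).2 (Filter.Eventually.of_forall fun t ht => ?_)
  exact (div_pos (hρpos t ht.1) ht.1).le

theorem rhoStar_nonneg {ρ : ℝ → ℝ} (hρpos : ∀ r : ℝ, 0 < r → 0 < ρ r)
    (hint : ∀ R, IntegrableOn (fun t : ℝ => ρ t / t) (Ioc 0 R)) {s : ℝ}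
    (hs : 0 ≤ s) : 0 ≤ rhoStar ρ s := by
  simpa [rhoStar] using rhoStar_mono hρpos hint le_rfl hs

theorem pow_pred_mul_kernel (hn : 0 < n) (ρ : ℝ → ℝ) {t : ℝ} (ht : 0 < t) :
    t ^ (n - 1) * kernel n ρ t = ρ t / t := by
  obtain ⟨m, rfl⟩ : ∃ m, n = m + 1 := ⟨n - 1, by omega⟩
  rw [kernel, Nat.add_sub_cancel, pow_succ]
  field_simp

/-- Polar coordinates: the Jacobian `t^(n-1)` turns `ρ(t)/t^n` into `ρ(t)/t`. -/
theorem lintegral_ball_kernel_norm (hn : 0 < n) {ρ : ℝ → ℝ} (hρpos : ∀ r : ℝ, 0 < r → 0 < ρ r)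
    (hint : ∀ R, IntegrableOn (fun t : ℝ => ρ t / t) (Ioc 0 R)) {R : ℝ} (hR : 0 ≤ R) :
    ∫⁻ u in ball (0 : Rn n) R, ‖kernel n ρ ‖u‖‖ₑ =
      ENNReal.ofReal (n * (volume : Measure (Rn n)).real (ball 0 1)) *
        ENNReal.ofReal (rhoStar ρ R) := by
  have : Nonempty (Fin n) := ⟨⟨0, hn⟩⟩
  have hnt : Nontrivial (Rn n) := inferInstance
  have hfin : Module.finrank ℝ (Rn n) = n := by simp
  have hi : IntegrableOn (fun u : Rn n => kernel n ρ ‖u‖) (ball 0 R) := by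
    rw [integrableOn_fun_norm_addHaar volume, hfin]
    refine ((hint R).mono_set Ioo_subset_Ioc_self).congr_fun (fun t ht => ?_) measurableSet_Ioo
    exact (pow_pred_mul_kernel hn ρ ht.1).symm
  have h0 : ∀ u : Rn n, ‖kernel n ρ ‖u‖‖ₑ = ENNReal.ofReal (kernel n ρ ‖u‖) := fun u =>
    Real.enorm_eq_ofReal (kernel_nonneg hn hρpos (norm_nonneg u))
  simp only [h0]
  rw [← ofReal_integral_eq_lintegral_ofReal hi (Filter.Eventually.of_forall fun u =>
    kernel_nonneg hn hρpos (norm_nonneg u)), ← ENNReal.ofReal_mul (by positivity)]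
  congr 1
  have h1 : ∫ u in ball (0 : Rn n) R, kernel n ρ ‖u‖ =
      ∫ u : Rn n, (Iio R).indicator (kernel n ρ) ‖u‖ := by
    rw [← integral_indicator measurableSet_ball]
    refine integral_congr_ae (Filter.Eventually.of_forall fun u => ?_)
    simp [indicator]
  rw [h1, integral_fun_norm_addHaar volume, hfin, nsmul_eq_mul, smul_eq_mul, mul_assoc]
  congr 2
  rw [rhoStar, intervalIntegral.integral_of_le hR, integral_Ioc_eq_integral_Ioo,
    ← Ioi_inter_Iio, ← setIntegral_indicator measurableSet_Iio]
  refine setIntegral_congr_fun measurableSet_Ioi fun t ht => ?_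
  by_cases htR : t < R
  · simp [htR, pow_pred_mul_kernel hn ρ (show 0 < t from ht)]
  · simp [htR]

/-! ### Measurability and size estimates for the fractional integral. -/

theorem aestronglyMeasurable_fracIntegrand_prod {ρ : ℝ → ℝ} (h : KernelRegularity n ρ)
    {f : Rn n → ℂ} (hf : AEStronglyMeasurable f) :
    AEStronglyMeasurable (fun p : Rn n × Rn n => fracIntegrand ρ f p.1 p.2)
      (volume.prod volume) := by
  refine AEStronglyMeasurable.smul (𝕜 := ℝ) ?_ hf.comp_snd
  exact ((measurable_kernel_norm h).comp (measurable_fst.sub measurable_snd)).aestronglyMeasurable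

theorem aestronglyMeasurable_fracIntegrand {ρ : ℝ → ℝ} (h : KernelRegularity n ρ)
    {f : Rn n → ℂ} (hf : AEStronglyMeasurable f) (x : Rn n) :
    AEStronglyMeasurable (fracIntegrand ρ f x) := by
  refine AEStronglyMeasurable.smul (𝕜 := ℝ) ?_ hf
  exact ((measurable_kernel_norm h).comp (measurable_const.sub measurable_id)).aestronglyMeasurable

theorem aestronglyMeasurable_fracIntegral {ρ : ℝ → ℝ} (h : KernelRegularity n ρ)
    {f : Rn n → ℂ} (hf : AEStronglyMeasurable f) : AEStronglyMeasurable (fracIntegral ρ f) :=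
  (aestronglyMeasurable_fracIntegrand_prod h hf).integral_prod_right'

theorem enorm_fracIntegrand (ρ : ℝ → ℝ) (f : Rn n → ℂ) (x y : Rn n) :
    ‖fracIntegrand ρ f x y‖ₑ = ‖kernel n ρ ‖x - y‖‖ₑ * ‖f y‖ₑ := by
  rw [fracIntegrand, enorm_smul]; rfl

theorem lintegral_kernel_norm_sub_le (hn : 0 < n) {ρ : ℝ → ℝ} (hρpos : ∀ r : ℝ, 0 < r → 0 < ρ r)
    (hint : ∀ R, IntegrableOn (fun t : ℝ => ρ t / t) (Ioc 0 R)) {R : ℝ} (hR : 0 ≤ R)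
    {S : Set (Rn n)} (hS : MeasurableSet S) {y : Rn n} (hSy : ∀ x ∈ S, ‖x - y‖ < R) :
    ∫⁻ x in S, ‖kernel n ρ ‖x - y‖‖ₑ ≤
      ENNReal.ofReal (n * (volume : Measure (Rn n)).real (ball 0 1)) *
        ENNReal.ofReal (rhoStar ρ R) := by
  rw [← lintegral_ball_kernel_norm hn hρpos hint hR, ← lintegral_indicator hS,
    ← lintegral_indicator measurableSet_ball,
    ← lintegral_sub_right_eq_self (μ := volume)
      ((ball (0 : Rn n) R).indicator fun u => ‖kernel n ρ ‖u‖‖ₑ) y]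
  refine lintegral_mono fun x => ?_
  by_cases hx : x ∈ S
  · have : x - y ∈ ball (0 : Rn n) R := mem_ball_zero_iff.2 (hSy x hx)
    simp [hx, this]
  · simp [hx]

/-- Tonelli: for fixed `y`, integrating the kernel in `x` first gives a bound independent of `y`. -/
theorem lintegral_fracIntegrand_le (hn : 0 < n) {ρ : ℝ → ℝ} (hρpos : ∀ r : ℝ, 0 < r → 0 < ρ r)
    (hint : ∀ R, IntegrableOn (fun t : ℝ => ρ t / t) (Ioc 0 R)) (h : KernelRegularity n ρ)
    {R : ℝ} (hR : 0 ≤ R) {f : Rn n → ℂ} (hf : AEStronglyMeasurable f)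
    {S T : Set (Rn n)} (hS : MeasurableSet S) (hT : MeasurableSet T)
    (hST : ∀ x ∈ S, ∀ y ∈ T, ‖x - y‖ < R) :
    ∫⁻ x in S, ∫⁻ y in T, ‖fracIntegrand ρ f x y‖ₑ ≤
      ENNReal.ofReal (n * (volume : Measure (Rn n)).real (ball 0 1)) *
        ENNReal.ofReal (rhoStar ρ R) * ∫⁻ y in T, ‖f y‖ₑ := by
  have hm : AEMeasurable (Function.uncurry fun x y : Rn n => ‖fracIntegrand ρ f x y‖ₑ)
      ((volume.restrict S).prod (volume.restrict T)) := by
    rw [Measure.prod_restrict]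
    exact (aestronglyMeasurable_fracIntegrand_prod h hf).enorm.restrict
  rw [lintegral_lintegral_swap hm, ← lintegral_const_mul' _ _ (by finiteness)]
  refine setLIntegral_mono_ae' hT (Filter.Eventually.of_forall fun y hy => ?_)
  simp only [enorm_fracIntegrand]
  rw [lintegral_mul_const' _ _ enorm_ne_top]
  gcongr
  exact lintegral_kernel_norm_sub_le hn hρpos hint hR hS fun x hx => hST x hx y hy

/-- The kernel is the almost decreasing function times `s^(-ε)`, and both factors are bounded away
from the origin. This makes the frozen far integral finite. -/
theorem exists_kernel_le (hn : 0 < n) {ρ : ℝ → ℝ} (hρpos : ∀ r : ℝ, 0 < r → 0 < ρ r)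
    {ε : ℝ} (hε : 0 < ε) (hρdec : AlmostDecreasing (fun r => ρ r / r ^ ((n : ℝ) - ε)))
    {δ : ℝ} (hδ : 0 < δ) : ∃ M : ℝ, ∀ s, δ ≤ s → ‖kernel n ρ s‖ ≤ M := by
  obtain ⟨C, hC, h⟩ := hρdec
  refine ⟨C * (ρ (δ / 2) / (δ / 2) ^ ((n : ℝ) - ε)) * δ ^ (-ε), fun s hs => ?_⟩
  have hs0 : 0 < s := hδ.trans_le hs
  -- Comparison at `δ / 2` keeps the inequality between the radii strict even when `s = δ`.
  have h1 := h (δ / 2) s (by positivity) (by linarith)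
  have h2 := hρpos s hs0
  have h3 : kernel n ρ s = ρ s / s ^ ((n : ℝ) - ε) * s ^ (-ε) := by
    rw [kernel, Real.rpow_neg hs0.le, Real.rpow_sub hs0, Real.rpow_natCast]
    have : s ^ ε ≠ 0 := (Real.rpow_pos_of_pos hs0 ε).ne'
    field_simp
  rw [Real.norm_of_nonneg (kernel_nonneg hn hρpos hs0.le), h3]
  have h4 : s ^ (-ε) ≤ δ ^ (-ε) := Real.rpow_le_rpow_of_nonpos hδ hs (by linarith)
  have h5 : 0 ≤ ρ s / s ^ ((n : ℝ) - ε) := by positivity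
  exact mul_le_mul h1 h4 (by positivity) (h5.trans h1)

/-- The distances from `x` and `z` to `y` differ by at most `r`, while the latter is at least `2r`;
their ratio therefore lies in `[1/2, 2]`. -/
theorem abs_kernel_sub_kernel_le {ρ : ℝ → ℝ} (hρpos : ∀ r : ℝ, 0 < r → 0 < ρ r)
    (hint : ∀ R, IntegrableOn (fun t : ℝ => ρ t / t) (Ioc 0 R)) {C : ℝ} (hC : 0 < C)
    (h : ∀ r s : ℝ, 0 < r → 0 < s → 1 / 2 ≤ r / s → r / s ≤ 2 →
      |ρ r / r ^ n - ρ s / s ^ n| ≤ C * |r - s| * (rhoStar ρ r / r ^ (n + 1)))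
    {x y z : Rn n} {r : ℝ} {j : ℕ} (hr : 0 < r) (hx : x ∈ ball z r)
    (hy1 : 2 ^ j * (2 * r) ≤ ‖z - y‖) (hy2 : ‖z - y‖ ≤ 2 ^ (j + 1) * (2 * r)) :
    |kernel n ρ ‖x - y‖ - kernel n ρ ‖z - y‖| ≤
      C * r * (rhoStar ρ (2 ^ (j + 1) * (2 * r)) / (2 ^ j * (2 * r)) ^ (n + 1)) := by
  have hxz : ‖x - z‖ < r := mem_ball_iff_norm.1 hx
  have hd : |‖z - y‖ - ‖x - y‖| ≤ r := by
    have h1 := abs_norm_sub_norm_le (z - y) (x - y)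
    rw [sub_sub_sub_cancel_right, norm_sub_rev z x] at h1
    linarith
  have h2r : 2 * r ≤ ‖z - y‖ :=
    (le_mul_of_one_le_left (by positivity) (one_le_pow₀ one_le_two)).trans hy1
  have hz0 : 0 < ‖z - y‖ := by linarith
  have hd' := abs_le.1 hd
  have hx0 : 0 < ‖x - y‖ := by linarith
  have h1 := h ‖z - y‖ ‖x - y‖ hz0 hx0
    (by rw [div_le_div_iff₀ two_pos hx0]; linarith) (by rw [div_le_iff₀ hx0]; linarith)
  rw [abs_sub_comm]
  refine h1.trans ?_
  have := rhoStar_nonneg hρpos hint hz0.le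
  gcongr
  · exact this.trans (rhoStar_mono hρpos hint hz0.le hy2)
  · exact rhoStar_mono hρpos hint hz0.le hy2

/-! ### Convergence and local integrability. -/

/-- The function vanishes almost everywhere off a compact set. -/
def AECompactSupport (f : Rn n → ℂ) : Prop :=
  ∃ K : Set (Rn n), IsCompact K ∧ ∀ᵐ y, y ∉ K → f y = 0

theorem AECompactSupport.mul_left {f : Rn n → ℂ} (hf : AECompactSupport f) (b : Rn n → ℂ) :
    AECompactSupport fun y => b y * f y := by
  obtain ⟨K, hK, h⟩ := hf
  exact ⟨K, hK, h.mono fun y hy hyK => by simp [hy hyK]⟩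

theorem AECompactSupport.exists_ball {f : Rn n → ℂ} (hf : AECompactSupport f) :
    ∃ R : ℝ, 0 < R ∧ ∀ᵐ y, y ∉ ball (0 : Rn n) R → f y = 0 := by
  obtain ⟨K, hK, h⟩ := hf
  obtain ⟨R, hR, hKR⟩ := hK.isBounded.subset_ball_lt 0 0
  exact ⟨R, hR, h.mono fun y hy hyR => hy fun hyK => hyR (hKR hyK)⟩

theorem lintegral_fracIntegrand_eq_setLIntegral {ρ : ℝ → ℝ} {f : Rn n → ℂ} {R : ℝ}
    (hf : ∀ᵐ y, y ∉ ball (0 : Rn n) R → f y = 0) (x : Rn n) :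
    ∫⁻ y, ‖fracIntegrand ρ f x y‖ₑ = ∫⁻ y in ball 0 R, ‖fracIntegrand ρ f x y‖ₑ := by
  rw [← lintegral_indicator measurableSet_ball]
  refine lintegral_congr_ae (hf.mono fun y hy => ?_)
  by_cases hyR : y ∈ ball (0 : Rn n) R
  · simp [hyR]
  · simp [hyR, enorm_fracIntegrand, hy hyR]

theorem MemLinftyc.aestronglyMeasurable {f : Rn n → ℂ} (hf : MemLinftyc f) :
    AEStronglyMeasurable f := hf.1.aestronglyMeasurable

/-- Local boundedness of `I_ρ f`, uniform on balls, is what makes `b I_ρ f` locally integrable for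
merely locally integrable `b`. -/
theorem MemLinftyc.exists_lintegral_fracIntegrand_le (hn : 0 < n) {ρ : ℝ → ℝ}
    (hρpos : ∀ r : ℝ, 0 < r → 0 < ρ r)
    (hint : ∀ R, IntegrableOn (fun t : ℝ => ρ t / t) (Ioc 0 R))
    {f : Rn n → ℂ} (hf : MemLinftyc f) (S : ℝ) :
    ∃ M : ℝ≥0∞, M ≠ ∞ ∧ ∀ x ∈ ball (0 : Rn n) S, ∫⁻ y, ‖fracIntegrand ρ f x y‖ₑ ≤ M := by
  obtain ⟨R, hR, hsupp⟩ := AECompactSupport.exists_ball hf.2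
  rcases le_or_gt S 0 with hS | hS
  · exact ⟨0, ENNReal.zero_ne_top, fun x hx => by simp [ball_eq_empty.2 hS] at hx⟩
  refine ⟨ENNReal.ofReal (n * (volume : Measure (Rn n)).real (ball 0 1)) *
    ENNReal.ofReal (rhoStar ρ (S + R)) * eLpNormEssSup f volume, ?_, fun x hx => ?_⟩
  · have := hf.1.2
    rw [eLpNorm_exponent_top] at this
    finiteness
  rw [lintegral_fracIntegrand_eq_setLIntegral hsupp]
  calc ∫⁻ y in ball 0 R, ‖fracIntegrand ρ f x y‖ₑ
      ≤ ∫⁻ y in ball 0 R, ‖kernel n ρ ‖y - x‖‖ₑ * eLpNormEssSup f volume := by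
        refine lintegral_mono_ae (ae_restrict_of_ae ?_)
        filter_upwards [enorm_ae_le_eLpNormEssSup f volume] with y hy
        rw [enorm_fracIntegrand, norm_sub_rev]
        gcongr
    _ = (∫⁻ y in ball 0 R, ‖kernel n ρ ‖y - x‖‖ₑ) * eLpNormEssSup f volume := by
        refine lintegral_mul_const' _ _ ?_
        have := hf.1.2
        rw [eLpNorm_exponent_top] at this
        exact this.ne
    _ ≤ _ := by
        gcongr
        refine lintegral_kernel_norm_sub_le hn hρpos hint (by positivity) measurableSet_ball
          fun y hy => ?_
        have h1 := mem_ball_zero_iff.1 hx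
        have h2 := mem_ball_zero_iff.1 hy
        linarith [norm_sub_le y x]

theorem MemLinftyc.integrable_fracIntegrand (hn : 0 < n) {ρ : ℝ → ℝ}
    (hρpos : ∀ r : ℝ, 0 < r → 0 < ρ r)
    (hint : ∀ R, IntegrableOn (fun t : ℝ => ρ t / t) (Ioc 0 R)) (h : KernelRegularity n ρ)
    {f : Rn n → ℂ} (hf : MemLinftyc f) (x : Rn n) : Integrable (fracIntegrand ρ f x) := by
  obtain ⟨M, hM, hx⟩ := hf.exists_lintegral_fracIntegrand_le hn hρpos hint (‖x‖ + 1)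
  exact ⟨aestronglyMeasurable_fracIntegrand h hf.aestronglyMeasurable x,
    (hx x (by simp)).trans_lt hM.lt_top⟩

theorem lintegral_lintegral_fracIntegrand_lt_top (hn : 0 < n) {ρ : ℝ → ℝ}
    (hρpos : ∀ r : ℝ, 0 < r → 0 < ρ r)
    (hint : ∀ R, IntegrableOn (fun t : ℝ => ρ t / t) (Ioc 0 R)) (h : KernelRegularity n ρ)
    {f : Rn n → ℂ} (hf : Integrable f) (hsupp : AECompactSupport f) {S : ℝ} (hS : 0 ≤ S) :
    ∫⁻ x in ball (0 : Rn n) S, ∫⁻ y, ‖fracIntegrand ρ f x y‖ₑ < ∞ := by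
  obtain ⟨R, hR, hsupp⟩ := hsupp.exists_ball
  simp only [lintegral_fracIntegrand_eq_setLIntegral hsupp]
  refine (lintegral_fracIntegrand_le hn hρpos hint h (R := S + R) (by positivity)
    hf.aestronglyMeasurable measurableSet_ball measurableSet_ball fun x hx y hy => ?_).trans_lt ?_
  · have h1 := mem_ball_zero_iff.1 hx
    have h2 := mem_ball_zero_iff.1 hy
    linarith [norm_sub_le x y]
  · exact ENNReal.mul_lt_top (by finiteness) ((setLIntegral_le_lintegral _ _).trans_lt hf.2)

theorem ae_integrable_fracIntegrand (hn : 0 < n) {ρ : ℝ → ℝ}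
    (hρpos : ∀ r : ℝ, 0 < r → 0 < ρ r)
    (hint : ∀ R, IntegrableOn (fun t : ℝ => ρ t / t) (Ioc 0 R)) (h : KernelRegularity n ρ)
    {f : Rn n → ℂ} (hf : Integrable f) (hsupp : AECompactSupport f) :
    ∀ᵐ x, Integrable (fracIntegrand ρ f x) := by
  have h1 : ∀ k : ℕ, ∀ᵐ x, x ∈ ball (0 : Rn n) k → ∫⁻ y, ‖fracIntegrand ρ f x y‖ₑ < ∞ := by
    intro k
    refine (ae_restrict_iff' measurableSet_ball).1 ?_
    have hm : AEMeasurable (fun x => ∫⁻ y, ‖fracIntegrand ρ f x y‖ₑ) :=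
      (aestronglyMeasurable_fracIntegrand_prod h hf.aestronglyMeasurable).enorm.lintegral_prod_right'
    exact ae_lt_top' hm.restrict (lintegral_lintegral_fracIntegrand_lt_top hn hρpos hint h hf hsupp
      k.cast_nonneg).ne
  filter_upwards [ae_all_iff.2 h1] with x hx
  obtain ⟨k, hk⟩ := exists_nat_gt ‖x‖
  exact ⟨aestronglyMeasurable_fracIntegrand h hf.aestronglyMeasurable x,
    hx k (mem_ball_zero_iff.2 hk)⟩

theorem locallyIntegrable_of_integrableOn_ball {g : Rn n → ℂ}
    (hg : ∀ S : ℝ, 0 < S → IntegrableOn g (ball 0 S)) : LocallyIntegrable g := fun x =>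
  ⟨ball 0 (‖x‖ + 1), isOpen_ball.mem_nhds (by simp), hg _ (by positivity)⟩

theorem locallyIntegrable_fracIntegral (hn : 0 < n) {ρ : ℝ → ℝ}
    (hρpos : ∀ r : ℝ, 0 < r → 0 < ρ r)
    (hint : ∀ R, IntegrableOn (fun t : ℝ => ρ t / t) (Ioc 0 R)) (h : KernelRegularity n ρ)
    {f : Rn n → ℂ} (hf : Integrable f) (hsupp : AECompactSupport f) :
    LocallyIntegrable (fracIntegral ρ f) :=
  locallyIntegrable_of_integrableOn_ball fun _ hS =>
    ⟨(aestronglyMeasurable_fracIntegral h hf.aestronglyMeasurable).restrict,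
      (lintegral_mono fun _ => enorm_integral_le_lintegral_enorm _).trans_lt
        (lintegral_lintegral_fracIntegrand_lt_top hn hρpos hint h hf hsupp hS.le)⟩

theorem MemLinftyc.locallyIntegrable_mul_fracIntegral (hn : 0 < n) {ρ : ℝ → ℝ}
    (hρpos : ∀ r : ℝ, 0 < r → 0 < ρ r)
    (hint : ∀ R, IntegrableOn (fun t : ℝ => ρ t / t) (Ioc 0 R)) (h : KernelRegularity n ρ)
    {b f : Rn n → ℂ} (hb : LocallyIntegrable b) (hf : MemLinftyc f) :
    LocallyIntegrable fun x => b x * fracIntegral ρ f x := by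
  refine locallyIntegrable_of_integrableOn_ball fun S hS => ?_
  obtain ⟨M, hM, hle⟩ := hf.exists_lintegral_fracIntegrand_le hn hρpos hint S
  refine ⟨(hb.aestronglyMeasurable.mul
    (aestronglyMeasurable_fracIntegral h hf.aestronglyMeasurable)).restrict, ?_⟩
  calc ∫⁻ x in ball 0 S, ‖b x * fracIntegral ρ f x‖ₑ
      ≤ ∫⁻ x in ball 0 S, ‖b x‖ₑ * M := by
        refine setLIntegral_mono_ae' measurableSet_ball (Filter.Eventually.of_forall fun x hx => ?_)
        rw [enorm_mul]
        gcongr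
        exact (enorm_integral_le_lintegral_enorm _).trans (hle x hx)
    _ = (∫⁻ x in ball 0 S, ‖b x‖ₑ) * M := lintegral_mul_const' _ _ hM
    _ < ∞ := ENNReal.mul_lt_top (integrableOn_ball hb 0 S).2 hM.lt_top

theorem MemLinftyc.integrable_mul {b f : Rn n → ℂ} (hb : LocallyIntegrable b)
    (hf : MemLinftyc f) : Integrable fun y => b y * f y := by
  obtain ⟨R, hR, hsupp⟩ := AECompactSupport.exists_ball hf.2
  have h1 : IntegrableOn (fun y => b y * f y) (ball 0 R) := by
    refine Integrable.mul_of_top_left (integrableOn_ball hb 0 R) (hf.1.restrict _)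
  have h2 := (integrable_indicator_iff measurableSet_ball).2 h1
  refine h2.congr (hsupp.mono fun y hy => ?_)
  by_cases hyR : y ∈ ball (0 : Rn n) R
  · simp [hyR]
  · simp [hyR, hy hyR]

/-! ### Dyadic annuli and the splitting of the commutator. -/

theorem exists_mem_dyadic_annulus {z y : Rn n} {s : ℝ} (hs : 0 < s) (hy : y ∉ ball z s) :
    ∃ j : ℕ, 2 ^ j * s ≤ ‖z - y‖ ∧ ‖z - y‖ < 2 ^ (j + 1) * s := by
  rw [mem_ball_iff_norm', not_lt] at hy
  obtain ⟨j, h1, h2⟩ := exists_nat_pow_near ((one_le_div hs).2 hy) one_lt_two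
  exact ⟨j, (le_div_iff₀ hs).1 h1, (div_lt_iff₀ hs).1 h2⟩

/-- The smoothness of the kernel, summed over dyadic annuli. -/
theorem lintegral_kernel_sub_kernel_le {ρ : ℝ → ℝ} (hρpos : ∀ r : ℝ, 0 < r → 0 < ρ r)
    (hint : ∀ R, IntegrableOn (fun t : ℝ => ρ t / t) (Ioc 0 R)) {C : ℝ} (hC : 0 < C)
    (h : ∀ r s : ℝ, 0 < r → 0 < s → 1 / 2 ≤ r / s → r / s ≤ 2 →
      |ρ r / r ^ n - ρ s / s ^ n| ≤ C * |r - s| * (rhoStar ρ r / r ^ (n + 1)))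
    {x z : Rn n} {r : ℝ} (hr : 0 < r) (hx : x ∈ ball z r) (g : Rn n → ℂ) :
    ∫⁻ y in (ball z (2 * r))ᶜ, ‖kernel n ρ ‖x - y‖ - kernel n ρ ‖z - y‖‖ₑ * ‖g y‖ₑ ≤
      ∑' j : ℕ, ENNReal.ofReal
        (C * r * (rhoStar ρ (2 ^ (j + 1) * (2 * r)) / (2 ^ j * (2 * r)) ^ (n + 1))) *
          ∫⁻ y in ball z (2 ^ (j + 1) * (2 * r)), ‖g y‖ₑ := by
  set T : ℕ → Set (Rn n) := fun j =>
    ball z (2 ^ (j + 1) * (2 * r)) \ ball z (2 ^ j * (2 * r)) with hT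
  have hcov : (ball z (2 * r))ᶜ ⊆ ⋃ j, T j := fun y hy => by
    obtain ⟨j, h1, h2⟩ := exists_mem_dyadic_annulus (by linarith) hy
    exact mem_iUnion.2 ⟨j, mem_ball_iff_norm'.2 h2, fun h3 => (mem_ball_iff_norm'.1 h3).not_ge h1⟩
  refine (lintegral_mono_set hcov).trans ((lintegral_iUnion_le _ _).trans
    (ENNReal.tsum_le_tsum fun j => ?_))
  rw [← lintegral_const_mul' _ _ ENNReal.ofReal_ne_top]
  refine le_trans (setLIntegral_mono_ae' (measurableSet_ball.diff measurableSet_ball)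
    (Filter.Eventually.of_forall fun y hy => ?_)) (lintegral_mono_set sdiff_subset)
  gcongr
  rw [← ofReal_norm, Real.norm_eq_abs]
  refine ENNReal.ofReal_le_ofReal (abs_kernel_sub_kernel_le hρpos hint hC h hr hx ?_
    (mem_ball_iff_norm'.1 hy.1).le)
  exact not_lt.1 fun h3 => hy.2 (mem_ball_iff_norm'.2 h3)

/-- Pointwise bound of the commutator, up to an additive constant, on a ball. -/
theorem exists_ae_enorm_commutator_add_le (hn : 0 < n) {ρ : ℝ → ℝ}
    (hρpos : ∀ r : ℝ, 0 < r → 0 < ρ r)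
    (hint : ∀ R, IntegrableOn (fun t : ℝ => ρ t / t) (Ioc 0 R))
    {ε : ℝ} (hε : 0 < ε) (hρdec : AlmostDecreasing (fun r => ρ r / r ^ ((n : ℝ) - ε)))
    (hreg : KernelRegularity n ρ) {b f : Rn n → ℂ} (hb : LocallyIntegrable b)
    (hf : MemLinftyc f) (c : ℂ) (z : Rn n) {s : ℝ} (hs : 0 < s) :
    ∃ d : ℂ, ∀ᵐ x, ‖commutator ρ b f x - d‖ₑ ≤
      ‖b x - c‖ₑ * ‖fracIntegral ρ f x‖ₑ +
        ((∫⁻ y in ball z s, ‖fracIntegrand ρ (fun y => (b y - c) * f y) x y‖ₑ) +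
          ∫⁻ y in (ball z s)ᶜ,
            ‖kernel n ρ ‖x - y‖ - kernel n ρ ‖z - y‖‖ₑ * ‖(b y - c) * f y‖ₑ) := by
  have hbc : LocallyIntegrable (fun y => b y - c) := hb.sub (locallyIntegrable_const c)
  set g : Rn n → ℂ := fun y => (b y - c) * f y with hg
  have hgi : Integrable g := hf.integrable_mul hbc
  -- The kernel frozen at `z`, cut off near its singularity. It is bounded, so its integral against
  -- `g` is a finite constant, and minus that integral is the constant `d`.
  set k : Rn n → ℝ := (ball z s)ᶜ.indicator (fun y => kernel n ρ ‖z - y‖) with hk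
  obtain ⟨M, hM⟩ := exists_kernel_le hn hρpos hε hρdec hs
  have hkm : Measurable k :=
    ((measurable_kernel_norm hreg).comp (measurable_const.sub measurable_id)).indicator
      measurableSet_ball.compl
  have hkM : ∀ y, ‖k y‖ ≤ max M 0 := fun y => by
    by_cases hy : y ∈ ball z s
    · simp [hk, hy]
    · rw [hk, indicator_of_mem (show y ∈ (ball z s)ᶜ from hy)]
      exact (hM _ (by rwa [mem_ball_iff_norm', not_lt] at hy)).trans (le_max_left _ _)
  have hki : Integrable fun y => k y • g y :=
    hgi.bdd_smul _ hkm.aestronglyMeasurable (Filter.Eventually.of_forall hkM)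
  refine ⟨-∫ y, k y • g y, ?_⟩
  filter_upwards [ae_integrable_fracIntegrand hn hρpos hint hreg hgi
      (AECompactSupport.mul_left hf.2 _),
    ae_integrable_fracIntegrand hn hρpos hint hreg (hf.integrable_mul hb)
      (AECompactSupport.mul_left hf.2 _)] with x hxg hxb
  have hxf := hf.integrable_fracIntegrand hn hρpos hint hreg x
  have h1 : fracIntegral ρ g x =
      fracIntegral ρ (fun y => b y * f y) x - c * fracIntegral ρ f x := by
    rw [fracIntegral, fracIntegral, fracIntegral, ← integral_const_mul,
      ← integral_sub hxb (hxf.const_mul c)]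
    refine integral_congr_ae (Filter.Eventually.of_forall fun y => ?_)
    simp only [fracIntegrand, hg, Complex.real_smul]
    ring
  have h2 : commutator ρ b f x - -∫ y, k y • g y =
      (b x - c) * fracIntegral ρ f x - ∫ y, (fracIntegrand ρ g x y - k y • g y) := by
    rw [integral_sub hxg hki, commutator]
    change _ = _ - (fracIntegral ρ g x - _)
    rw [h1]
    ring
  rw [h2]
  refine (enorm_sub_le).trans ?_
  rw [enorm_mul]
  gcongr
  refine (enorm_integral_le_lintegral_enorm _).trans ?_
  rw [← lintegral_add_compl _ (measurableSet_ball (x := z) (ε := s))]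
  refine add_le_add (setLIntegral_mono_ae' measurableSet_ball
    (Filter.Eventually.of_forall fun y hy => ?_)) (setLIntegral_mono_ae' measurableSet_ball.compl
    (Filter.Eventually.of_forall fun y hy => ?_))
  · simp [hk, hy]
  · rw [hk, indicator_of_mem hy, fracIntegrand, ← sub_smul, enorm_smul]
    rfl

/-- The volume contributes power `n` of the dilated radius against power `n + 1` in the denominator.
The leftover ratio of `r` to `2^j · 2r` is the decay `2^{-j}`. -/
theorem ofReal_mul_volume_ball_eq {C r R : ℝ} (hC : 0 < C) (hr : 0 < r) (hR : 0 ≤ R) (z : Rn n)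
    (j : ℕ) :
    ENNReal.ofReal (C * r * (R / (2 ^ j * (2 * r)) ^ (n + 1))) *
        volume (ball z (2 ^ (j + 1) * (2 * r))) =
      ENNReal.ofReal (C * 2 ^ n / 2) * volume (ball (0 : Rn n) 1) * 2⁻¹ ^ j *
        ENNReal.ofReal R := by
  have h1 := volume_ball_mul z (0 : Rn n) (t := 2 ^ (j + 1) * (2 * r)) (by positivity) 1
  rw [mul_one] at h1
  have h2 : (2⁻¹ : ℝ≥0∞) ^ j = ENNReal.ofReal (2⁻¹ ^ j) := by
    rw [ENNReal.ofReal_pow (by positivity), ENNReal.ofReal_inv_of_pos two_pos, ENNReal.ofReal_ofNat]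
  rw [h1, h2, ← mul_assoc, ← ENNReal.ofReal_mul (by positivity), mul_right_comm _ (volume _),
    mul_right_comm _ (volume _), ← ENNReal.ofReal_mul (by positivity),
    ← ENNReal.ofReal_mul (by positivity)]
  congr 2
  have h3 : (2 : ℝ) ^ (j + 1) * (2 * r) = 2 * (2 ^ j * (2 * r)) := by ring
  have h4 : 0 < (2 : ℝ) ^ j * (2 * r) := by positivity
  rw [h3, mul_pow 2 (2 ^ j * (2 * r)) n, pow_succ (2 ^ j * (2 * r)), inv_pow]
  field_simp

/-! ### The sharp maximal estimate. -/

theorem exists_sharpMaximal_commutator_le (hn : 0 < n) {ρ ψ : ℝ → ℝ}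
    (hρpos : ∀ r : ℝ, 0 < r → 0 < ρ r) (hψpos : ∀ r : ℝ, 0 < r → 0 < ψ r)
    (hint : ∀ R, IntegrableOn (fun t : ℝ => ρ t / t) (Ioc 0 R))
    (hψ : AlmostIncreasing ψ) {ε : ℝ} (hε : 0 < ε)
    (hρdec : AlmostDecreasing (fun r => ρ r / r ^ ((n : ℝ) - ε)))
    (hreg : KernelRegularity n ρ) {η : ℝ} (hη : 1 < η) :
    ∃ C : ℝ≥0∞, C ≠ ∞ ∧ ∀ b : Rn n → ℂ, MemCampanato ψ b → ∀ f : Rn n → ℂ, MemLinftyc f →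
      LocallyIntegrable (commutator ρ b f) → ∀ x, sharpMaximal (commutator ρ b f) x ≤
        C * campanatoNorm ψ b *
          ((fracMaximal (fun r => ψ r ^ η) (fun y => ‖fracIntegral ρ f y‖ ^ η) x) ^ (1 / η) +
           (fracMaximal (fun r => (rhoStar ρ r * ψ r) ^ η) (fun y => ‖f y‖ ^ η) x) ^ (1 / η)) := by
  obtain ⟨C₀, hC₀, hosc⟩ := exists_laverage_deviation_mul_le (n := n) hψpos hψ hη
  have hreg' := hreg
  obtain ⟨Cρ, hCρ, hker⟩ := hreg'
  have hη0 : 0 < η := by linarith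
  set σ : ℝ≥0∞ := ENNReal.ofReal (n * (volume : Measure (Rn n)).real (ball 0 1)) with hσ
  set τ : ℝ≥0∞ := ENNReal.ofReal (Cρ * 2 ^ n / 2) * volume (ball (0 : Rn n) 1) with hτ
  have hσ1 : σ ≠ ∞ := ENNReal.ofReal_ne_top
  have hτ1 : τ ≠ ∞ := ENNReal.mul_ne_top ENNReal.ofReal_ne_top (volume_ball_ne_top _ _)
  have hG := geomMoment_ne_top 1
  refine ⟨2 * (2 ^ n * C₀ + (σ * 2 ^ n * C₀ + τ * C₀ * (2 * geomMoment 1))), by finiteness,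
    fun b hb f hf hloc x₀ => ?_⟩
  set N := campanatoNorm ψ b with hN
  set X := (fracMaximal (fun r => ψ r ^ η) (fun y => ‖fracIntegral ρ f y‖ ^ η) x₀) ^ (1 / η) with hX
  set Y := (fracMaximal (fun r => (rhoStar ρ r * ψ r) ^ η) (fun y => ‖f y‖ ^ η) x₀) ^ (1 / η)
    with hY
  refine iSup_le fun z => iSup_le fun r => iSup_le fun hr => iSup_le fun hx₀ => ?_
  set c := ⨍ w in ball z (2 * r), b w ∂volume with hc
  have h2r : 0 < 2 * r := by linarith
  have hmem : ∀ j : ℕ, x₀ ∈ ball z (2 ^ j * (2 * r)) := fun j => by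
    refine ball_subset_ball ?_ hx₀
    have : 2 * r ≤ 2 ^ j * (2 * r) := le_mul_of_one_le_left h2r.le (one_le_pow₀ one_le_two)
    linarith
  have hIf : AEStronglyMeasurable (fracIntegral ρ f) :=
    aestronglyMeasurable_fracIntegral hreg hf.aestronglyMeasurable
  -- the mean of `|b - c| |f|` over dilates, weighted by `ρ*`
  have hdil : ∀ j : ℕ, ENNReal.ofReal (rhoStar ρ (2 ^ (j + 1) * (2 * r))) *
      ⨍⁻ y in ball z (2 ^ j * (2 * r)), ‖b y - c‖ₑ * ‖f y‖ₑ ∂volume ≤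
        C₀ * (j + 1) * N * Y := by
    intro j
    have hpos : 0 < 2 ^ (j + 1) * (2 * r) := by positivity
    have h1 := hosc b hb f hf.aestronglyMeasurable z (2 * r) j h2r
    have hρ0 := rhoStar_nonneg hρpos hint hpos.le
    have h2 := mul_laverage_rpow_le_fracMaximal (w := fun r => rhoStar ρ r * ψ r) hη0 (v := f)
      hpos (hmem (j + 1)) (mul_nonneg hρ0 (hψpos _ hpos).le)
    rw [ENNReal.ofReal_mul hρ0] at h2
    refine (mul_le_mul_right h1 _).trans ?_
    rw [mul_left_comm, ← mul_assoc (ENNReal.ofReal _)]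
    gcongr
  have hfirst : ⨍⁻ x in ball z r, ‖b x - c‖ₑ * ‖fracIntegral ρ f x‖ₑ ∂volume ≤
      2 ^ n * C₀ * N * X := by
    have h1 := hosc b hb _ hIf z (2 * r) 0 h2r
    have h2 := mul_laverage_rpow_le_fracMaximal (w := ψ) hη0 (v := fracIntegral ρ f)
      (by positivity) (hmem 1) (hψpos _ (by positivity)).le
    simp only [pow_zero, one_mul, Nat.cast_zero, zero_add, mul_one] at h1
    calc _ ≤ 2 ^ n * ⨍⁻ x in ball z (2 * r), ‖b x - c‖ₑ * ‖fracIntegral ρ f x‖ₑ ∂volume :=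
          laverage_ball_le_two _ z hr
      _ ≤ 2 ^ n * (C₀ * N * X) := by gcongr; exact h1.trans (by gcongr)
      _ = _ := by ring
  have hg : AEStronglyMeasurable (fun y => (b y - c) * f y) :=
    (hb.1.aestronglyMeasurable.sub aestronglyMeasurable_const).mul hf.aestronglyMeasurable
  have hsecond : ⨍⁻ x in ball z r,
      (∫⁻ y in ball z (2 * r), ‖fracIntegrand ρ (fun y => (b y - c) * f y) x y‖ₑ) ∂volume ≤
        σ * 2 ^ n * C₀ * N * Y := by
    -- Distances are below `3r`; the radius `4r` is taken to match the weight in `hdil 0`.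
    have h1 := lintegral_fracIntegrand_le hn hρpos hint hreg (R := 2 * (2 * r)) (by positivity) hg
      (measurableSet_ball (x := z) (ε := r)) (measurableSet_ball (x := z) (ε := 2 * r))
      (fun x hx y hy => by
        have h3 := mem_ball_iff_norm.1 hx
        have h4 := mem_ball_iff_norm'.1 hy
        have h5 := norm_add_le (x - z) (z - y)
        rw [sub_add_sub_cancel] at h5
        linarith)
    rw [laverage_ball_eq]
    refine ENNReal.div_le_of_le_mul (h1.trans ?_)
    have h2 := hdil 0
    simp only [pow_zero, one_mul, Nat.cast_zero, zero_add, mul_one, pow_one] at h2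
    rw [← volume_mul_laverage_ball, volume_ball_mul z z two_pos, ENNReal.ofReal_pow zero_le_two,
      ENNReal.ofReal_ofNat]
    simp only [enorm_mul]
    calc _ = σ * 2 ^ n * (ENNReal.ofReal (rhoStar ρ (2 * (2 * r))) *
          ⨍⁻ y in ball z (2 * r), ‖b y - c‖ₑ * ‖f y‖ₑ ∂volume) * volume (ball z r) := by ring
      _ ≤ σ * 2 ^ n * (C₀ * N * Y) * volume (ball z r) := by gcongr
      _ = _ := by ring
  have hthird : ∀ x ∈ ball z r, ∫⁻ y in (ball z (2 * r))ᶜ,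
      ‖kernel n ρ ‖x - y‖ - kernel n ρ ‖z - y‖‖ₑ * ‖(b y - c) * f y‖ₑ ≤
        τ * C₀ * (2 * geomMoment 1) * N * Y := by
    intro x hx
    refine (lintegral_kernel_sub_kernel_le hρpos hint hCρ hker hr hx _).trans ?_
    have hterm : ∀ j : ℕ, ENNReal.ofReal
        (Cρ * r * (rhoStar ρ (2 ^ (j + 1) * (2 * r)) / (2 ^ j * (2 * r)) ^ (n + 1))) *
          ∫⁻ y in ball z (2 ^ (j + 1) * (2 * r)), ‖(b y - c) * f y‖ₑ ≤
        τ * C₀ * 2 * N * Y * (((j + 1 : ℕ) : ℝ≥0∞) ^ (1 : ℝ) * 2⁻¹ ^ j) := by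
      intro j
      rw [← volume_mul_laverage_ball, ← mul_assoc, ofReal_mul_volume_ball_eq hCρ hr
        (rhoStar_nonneg hρpos hint (by positivity))]
      simp only [enorm_mul]
      -- `hdil` at index `j + 1` carries `ρ*` at one doubling more than the annulus estimate gives.
      have hmono : rhoStar ρ (2 ^ (j + 1) * (2 * r)) ≤ rhoStar ρ (2 ^ (j + 1 + 1) * (2 * r)) := by
        refine rhoStar_mono hρpos hint (by positivity) ?_
        gcongr
        · norm_num
        · omega
      calc _ ≤ τ * 2⁻¹ ^ j * (ENNReal.ofReal (rhoStar ρ (2 ^ (j + 1 + 1) * (2 * r))) *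
            ⨍⁻ y in ball z (2 ^ (j + 1) * (2 * r)), ‖b y - c‖ₑ * ‖f y‖ₑ ∂volume) := by
            rw [mul_assoc (_ * 2⁻¹ ^ j)]
            gcongr
        _ ≤ τ * 2⁻¹ ^ j * (C₀ * ((j + 1 : ℕ) + 1) * N * Y) := mul_le_mul_right (hdil (j + 1)) _
        -- The factor `j + 2` is at most `2(j + 1)`, which matches the terms of `geomMoment 1`.
        _ ≤ τ * 2⁻¹ ^ j * (C₀ * (2 * ((j + 1 : ℕ) : ℝ≥0∞)) * N * Y) := by
            gcongr
            rw [two_mul]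
            gcongr
            exact_mod_cast Nat.le_add_left 1 j
        _ = _ := by rw [ENNReal.rpow_one]; ring
    refine (ENNReal.tsum_le_tsum hterm).trans (le_of_eq ?_)
    rw [ENNReal.tsum_mul_left, geomMoment]
    ring
  obtain ⟨d, hd⟩ := exists_ae_enorm_commutator_add_le hn hρpos hint hε hρdec hreg hb.1 hf c z h2r
  refine (meanOsc_le hr (integrableOn_ball hloc z r) d).trans ?_
  have hmF : AEMeasurable (fun x => ∫⁻ y in ball z (2 * r),
      ‖fracIntegrand ρ (fun y => (b y - c) * f y) x y‖ₑ) (volume.restrict (ball z r)) := by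
    have h1 := (aestronglyMeasurable_fracIntegrand_prod hreg hg).enorm.mono_measure
      (show (volume : Measure (Rn n)).prod (volume.restrict (ball z (2 * r))) ≤
        volume.prod volume from Measure.prod_mono le_rfl Measure.restrict_le_self)
    exact h1.lintegral_prod_right'.restrict
  have hsum : ⨍⁻ x in ball z r, ‖commutator ρ b f x - d‖ₑ ∂volume ≤
      2 ^ n * C₀ * N * X + (σ * 2 ^ n * C₀ * N * Y + τ * C₀ * (2 * geomMoment 1) * N * Y) := by
    -- The far part is bounded uniformly for `x` in the ball, so it enters as a constant.
    calc _ ≤ ⨍⁻ x in ball z r, (‖b x - c‖ₑ * ‖fracIntegral ρ f x‖ₑ +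
          ((∫⁻ y in ball z (2 * r), ‖fracIntegrand ρ (fun y => (b y - c) * f y) x y‖ₑ) +
            τ * C₀ * (2 * geomMoment 1) * N * Y)) ∂volume := by
          refine laverage_mono_ae ?_
          filter_upwards [ae_restrict_of_ae hd, ae_restrict_mem measurableSet_ball] with x hx hxz
          exact hx.trans (by gcongr; exact hthird x hxz)
      _ = ⨍⁻ x in ball z r, ‖b x - c‖ₑ * ‖fracIntegral ρ f x‖ₑ ∂volume +
          (⨍⁻ x in ball z r,
            (∫⁻ y in ball z (2 * r), ‖fracIntegrand ρ (fun y => (b y - c) * f y) x y‖ₑ) ∂volume +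
            τ * C₀ * (2 * geomMoment 1) * N * Y) := by
          rw [laverage_add_right _ (hmF.add_const _),
            laverage_add_right _ aemeasurable_const, laverage_ball_const _ z hr]
      _ ≤ _ := by gcongr
  calc _ ≤ 2 * (2 ^ n * C₀ * N * X +
        (σ * 2 ^ n * C₀ * N * Y + τ * C₀ * (2 * geomMoment 1) * N * Y)) := by gcongr
    _ ≤ 2 * (2 ^ n * C₀ * N * (X + Y) +
        (σ * 2 ^ n * C₀ * N * (X + Y) + τ * C₀ * (2 * geomMoment 1) * N * (X + Y))) := by
        gcongr
        · exact le_self_add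
        · exact le_add_self
        · exact le_add_self
    _ = _ := by ring

end Campanato

theorem proposition6p2 (n : ℕ) (hn : 0 < n) (ρ ψ : ℝ → ℝ)
    (hρpos : ∀ r : ℝ, 0 < r → 0 < ρ r) (hψpos : ∀ r : ℝ, 0 < r → 0 < ψ r)
    (hρint : IntegrableOn (fun t : ℝ => ρ t / t) (Ioc 0 1))
    (hψ : Campanato.AlmostIncreasing ψ)
    (ε : ℝ) (hε : 0 < ε)
    (hρdec : Campanato.AlmostDecreasing (fun r => ρ r / r ^ ((n : ℝ) - ε)))
    (hρreg : Campanato.KernelRegularity n ρ)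
    (η : ℝ) (hη : 1 < η) :
    ∃ C : ℝ≥0, 0 < C ∧
      ∀ b : Campanato.Rn n → ℂ, Campanato.MemCampanato ψ b →
      ∀ f : Campanato.Rn n → ℂ, Campanato.MemLinftyc f →
        -- the commutator is well defined a.e. and locally integrable
        (∀ x, Integrable (Campanato.fracIntegrand ρ f x)) ∧
        (∀ᵐ x, Integrable (Campanato.fracIntegrand ρ (fun y => b y * f y) x)) ∧
        LocallyIntegrable (Campanato.commutator ρ b f) ∧
        -- the pointwise estimate
        ∀ x, Campanato.sharpMaximal (Campanato.commutator ρ b f) x ≤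
          C * Campanato.campanatoNorm ψ b *
            ((Campanato.fracMaximal (fun r => ψ r ^ η)
                (fun y => ‖Campanato.fracIntegral ρ f y‖ ^ η) x) ^ (1 / η) +
             (Campanato.fracMaximal (fun r => (Campanato.rhoStar ρ r * ψ r) ^ η)
                (fun y => ‖f y‖ ^ η) x) ^ (1 / η)) := by
  have hint := Campanato.integrableOn_div_Ioc hρint hρreg
  obtain ⟨C, hC, hle⟩ := Campanato.exists_sharpMaximal_commutator_le hn hρpos hψpos hint hψ hε
    hρdec hρreg hη
  -- Adding 1 only ensures that the constant is positive.
  refine ⟨C.toNNReal + 1, by positivity, fun b hb f hf => ?_⟩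
  have hbf := hf.integrable_mul hb.1
  have hsupp := Campanato.AECompactSupport.mul_left hf.2 b
  have hloc : LocallyIntegrable (Campanato.commutator ρ b f) :=
    (hf.locallyIntegrable_mul_fracIntegral hn hρpos hint hρreg hb.1).sub
      (Campanato.locallyIntegrable_fracIntegral hn hρpos hint hρreg hbf hsupp)
  refine ⟨hf.integrable_fracIntegrand hn hρpos hint hρreg,
    Campanato.ae_integrable_fracIntegrand hn hρpos hint hρreg hbf hsupp, hloc, fun x => ?_⟩
  refine (hle b hb f hf hloc x).trans ?_
  rw [ENNReal.coe_add, ENNReal.coe_toNNReal hC]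
  gcongr
  exact le_self_add
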